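/- Let $L|K$ be a field extension, $v$ a (Krull) valuation on $L$, written additively, and let $K$ carry the restriction of $v$; denote by $\mathcal{O}_L,\mathcal{O}_K$ the valuation rings, by $vL, vK$ the value groups and by $Lv,Kv$ the residue fields. Let $q$ be a prime, and let $(L|K,v)$ be a Kummer extension of degree $q$ (that is, $L|K$ is Galois of degree $q$ and $K$ contains a primitive $q$-th root of unity) with ramification index $\mathrm{e}(L|K)=(vL:vK)=q$ (so that the extension is unibranched and defectless). A Kummer generator is an element $\eta$ with $L=K(\eta)$ and $\eta^q\in K$; a $1$-unit is an element $1+b$ with $vb>0$. For an ordered abelian group $\Gamma$ and $\gamma\in\Gamma$, let $\mathcal{C}_\Gamma(\gamma)$ be the smallest convex subgroup containing $\gamma$ and, if $\gamma\neq 0$, let $\mathcal{C}^+_\Gamma(\gamma)$ be the largest convex subgroup not containing $\gamma$ and $\mathcal{A}_\Gamma(\gamma)=\mathcal{C}_\Gamma(\gamma)/\mathcal{C}^+_\Gamma(\gamma)$ with the induced order. An ordered abelian group is discrete if each of its elements has an immediate successor. For an ideal $I$ of $\mathcal{O}_L$ put $vI=\{va\mid 0\ne a\in I\}$. Then at least one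 of the following cases occurs (in case (ii), for any given choice of $\zeta_q$): (i) There is a Kummer generator $\eta$ with $v\eta<0$ and $\mathcal{O}_L=\bigcup_{c\in K^\times,\,vc\eta>0}\mathcal{O}_K[c\eta]$. (ii) $\operatorname{char}K=0$, $\operatorname{char}Kv=q$, and for a primitive $q$-th root of unity $\zeta_q\in K$ there are a Kummer generator $\eta$ which is a $1$-unit and $j\in\{1,\dots,q-1\}$ such that $\xi=\frac{\eta-1}{1-\zeta_q}$ satisfies $v\xi<0$ and $\mathcal{O}_L=\bigcup_{c\in K^\times,\,vc\xi^j>0}\mathcal{O}_K[c\xi^j]$. Case (i) always occurs if $q\neq\operatorname{char}Kv$. For every $\eta$ as in (i), let $I=(c\eta\mid c\in K,\ vc\eta>0)$, an ideal of $\mathcal{O}_L$. Then $\Omega_{\mathcal{O}_L|\mathcal{O}_K}\cong I/qI^q$ as $\mathcal{O}_L$-modules. Moreover, $\Omega_{\mathcal{O}_L|\mathcal{O}_K}=0$ if and only if $vI\cap\mathcal{C}_{vL}(vq)=\emptyset$ and, for every $c\in K^\times$ with $vc\eta>0$ and $vI\cap\mathcal{C}^+_{vL}(vc\eta)=\emptyset$,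 the archimedean component $\mathcal{A}_{vK}(q\,vc\eta)$ is not discrete (here $q\,vc\eta\in vK$). If $q\ne\operatorname{char}Kv$, then $vq=0$ and the condition $vI\cap\mathcal{C}_{vL}(vq)=\emptyset$ always holds. For all $\zeta_q,\eta,j$ as in (ii), let $I=(c\xi^{j-1}\mid c\in K^\times,\ vc\xi^j>0)$, an ideal of $\mathcal{O}_L$. Then $\Omega_{\mathcal{O}_L|\mathcal{O}_K}\cong I/I^q$ as $\mathcal{O}_L$-modules, and $\Omega_{\mathcal{O}_L|\mathcal{O}_K}\neq 0$. -/

import Mathlib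

/-! ### Convex subgroups and archimedean components of an ordered abelian group -/

/-- A subgroup of an ordered abelian group is convex if it contains every element lying between
two of its elements. -/
def IsConvexSubgroup {G : Type*} [AddCommGroup G] [LinearOrder G] (H : AddSubgroup G) : Prop :=
  ∀ a ∈ H, ∀ b ∈ H, ∀ x, a ≤ x → x ≤ b → x ∈ H

/-- `C(γ)`: the smallest convex subgroup containing `γ`. -/
def convexC {G : Type*} [AddCommGroup G] [LinearOrder G] (γ : G) : AddSubgroup G :=
  sInf {H | IsConvexSubgroup H ∧ γ ∈ H}

/-- `C⁺(γ)`, for `γ ≠ 0`: the largest convex subgroup not containing `γ`. -/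
def convexCPlus {G : Type*} [AddCommGroup G] [LinearOrder G] (γ : G) : AddSubgroup G :=
  sSup {H | IsConvexSubgroup H ∧ γ ∉ H}

theorem convexC_isLeast {G : Type*} [AddCommGroup G] [LinearOrder G] (γ : G) :
    IsLeast {H : AddSubgroup G | IsConvexSubgroup H ∧ γ ∈ H} (convexC γ) := by
  refine ⟨⟨fun a ha b hb x hax hxb => ?_, ?_⟩, fun H hH => sInf_le hH⟩
  · rw [convexC, AddSubgroup.mem_sInf] at *
    exact fun H hH => hH.1 a (ha H hH) b (hb H hH) x hax hxb
  · rw [convexC, AddSubgroup.mem_sInf]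
    exact fun H hH => hH.2

theorem IsConvexSubgroup.le_total {G : Type*} [AddCommGroup G] [LinearOrder G]
    [IsOrderedAddMonoid G] {H₁ H₂ : AddSubgroup G} (h₁ : IsConvexSubgroup H₁)
    (h₂ : IsConvexSubgroup H₂) : H₁ ≤ H₂ ∨ H₂ ≤ H₁ := by
  have key : ∀ H : AddSubgroup G, IsConvexSubgroup H → ∀ a b : G, b ∈ H → |a| ≤ |b| → a ∈ H := by
    intro H hH a b hb hab
    have hb' : |b| ∈ H := by
      rcases abs_choice b with h | h <;> rw [h]
      · exact hb
      · exact H.neg_mem hb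
    have := abs_le.1 hab
    exact hH _ (H.neg_mem hb') _ hb' a this.1 this.2
  by_contra! hcon
  obtain ⟨a, ha₁, ha₂⟩ := SetLike.not_le_iff_exists.1 hcon.1
  obtain ⟨b, hb₂, hb₁⟩ := SetLike.not_le_iff_exists.1 hcon.2
  rcases _root_.le_total |a| |b| with h | h
  · exact ha₂ (key H₂ h₂ a b hb₂ h)
  · exact hb₁ (key H₁ h₁ b a ha₁ h)

theorem mem_convexCPlus {G : Type*} [AddCommGroup G] [LinearOrder G]
    [IsOrderedAddMonoid G] {γ : G} (hγ : γ ≠ 0) {x : G} :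
    x ∈ convexCPlus γ ↔ ∃ H : AddSubgroup G, (IsConvexSubgroup H ∧ γ ∉ H) ∧ x ∈ H := by
  rw [convexCPlus, AddSubgroup.mem_sSup_of_directedOn]
  · rfl
  · refine ⟨⊥, ⟨fun a ha b hb x hax hxb => ?_, ?_⟩⟩
    · rw [AddSubgroup.mem_bot] at *
      subst ha hb
      exact le_antisymm hxb hax
    · rwa [AddSubgroup.mem_bot]
  · intro H₁ h₁ H₂ h₂
    rcases h₁.1.le_total h₂.1 with h | h
    · exact ⟨H₂, h₂, h, le_rfl⟩
    · exact ⟨H₁, h₁, le_rfl, h⟩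

theorem convexCPlus_isGreatest {G : Type*} [AddCommGroup G] [LinearOrder G]
    [IsOrderedAddMonoid G] {γ : G} (hγ : γ ≠ 0) :
    IsGreatest {H : AddSubgroup G | IsConvexSubgroup H ∧ γ ∉ H} (convexCPlus γ) := by
  refine ⟨⟨fun a ha b hb x hax hxb => ?_, fun h => ?_⟩, fun H hH => le_sSup hH⟩
  · rw [mem_convexCPlus hγ] at *
    obtain ⟨H₁, h₁, ha⟩ := ha
    obtain ⟨H₂, h₂, hb⟩ := hb
    rcases h₁.1.le_total h₂.1 with h | h
    · exact ⟨H₂, h₂, h₂.1 a (h ha) b hb x hax hxb⟩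
    · exact ⟨H₁, h₁, h₁.1 a ha b (h hb) x hax hxb⟩
  · obtain ⟨H, hH, hx⟩ := (mem_convexCPlus hγ).1 h
    exact hH.2 hx

theorem convexCPlus_isConvex {G : Type*} [AddCommGroup G] [LinearOrder G]
    [IsOrderedAddMonoid G] (γ : G) : IsConvexSubgroup (convexCPlus γ) := by
  by_cases hγ : γ = 0
  · have : convexCPlus γ = ⊥ := by
      rw [convexCPlus, sSup_eq_bot]
      exact fun H hH => (hH.2 (hγ ▸ H.zero_mem)).elim
    rw [this]
    intro a ha b hb x hax hxb
    rw [AddSubgroup.mem_bot] at *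
    subst ha hb
    exact le_antisymm hxb hax
  · exact (convexCPlus_isGreatest hγ).1.1

/-- `A(γ) = C(γ) / C⁺(γ)`: the archimedean component associated with `γ`. -/
def ArchComponent {G : Type*} [AddCommGroup G] [LinearOrder G] (γ : G) : Type _ :=
  convexC γ ⧸ (convexCPlus γ).addSubgroupOf (convexC γ)

namespace ArchComponent

instance {G : Type*} [AddCommGroup G] [LinearOrder G] (γ : G) : AddCommGroup (ArchComponent γ) :=
  inferInstanceAs (AddCommGroup (convexC γ ⧸ (convexCPlus γ).addSubgroupOf (convexC γ)))

/-- The class in `A(γ)` of an element of `C(γ)`. -/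
def mk {G : Type*} [AddCommGroup G] [LinearOrder G] (γ : G) : convexC γ →+ ArchComponent γ :=
  QuotientAddGroup.mk' _

theorem mk_surjective {G : Type*} [AddCommGroup G] [LinearOrder G] (γ : G) :
    Function.Surjective (mk γ) := QuotientAddGroup.mk'_surjective _

theorem mk_eq_mk {G : Type*} [AddCommGroup G] [LinearOrder G] {γ : G} {a b : convexC γ} :
    mk γ a = mk γ b ↔ ((b : G) - a) ∈ convexCPlus γ := by
  have : mk γ a = mk γ b ↔ -a + b ∈ (convexCPlus γ).addSubgroupOf (convexC γ) :=
    QuotientAddGroup.eq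
  rw [this, AddSubgroup.mem_addSubgroupOf, neg_add_eq_sub]
  rfl

/-- The order on `A(γ)` induced by the order on `C(γ)`. -/
instance {G : Type*} [AddCommGroup G] [LinearOrder G] (γ : G) : LE (ArchComponent γ) :=
  ⟨fun x y => ∃ a b : convexC γ, mk γ a = x ∧ mk γ b = y ∧ a ≤ b⟩

theorem mk_le_mk {G : Type*} [AddCommGroup G] [LinearOrder G] [IsOrderedAddMonoid G] {γ : G}
    {a b : convexC γ} : mk γ a ≤ mk γ b ↔ a ≤ b ∨ mk γ a = mk γ b := by
  constructor
  · rintro ⟨a', b', ha, hb, hab⟩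
    rw [or_iff_not_imp_left, not_le]
    intro hba
    rw [mk_eq_mk] at *
    refine convexCPlus_isConvex γ _ ((convexCPlus γ).add_mem hb
      ((convexCPlus γ).neg_mem ha)) 0 (convexCPlus γ).zero_mem _ ?_ ?_
    · have h : (a' : G) - b' ≤ 0 := sub_nonpos.2 hab
      calc (b : G) - b' + -(a - a') = (b - a) + (a' - b') := by abel
        _ ≤ (b - a) + 0 := by gcongr
        _ = b - a := add_zero _
    · exact sub_nonpos.2 (le_of_lt hba)
  · rintro (h | h)
    · exact ⟨a, b, rfl, rfl, h⟩
    · exact ⟨b, b, h.symm, rfl, le_rfl⟩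

noncomputable instance {G : Type*} [AddCommGroup G] [LinearOrder G] [IsOrderedAddMonoid G]
    (γ : G) : LinearOrder (ArchComponent γ) where
  le_refl x := by
    obtain ⟨a, rfl⟩ := mk_surjective γ x
    exact mk_le_mk.2 (Or.inl le_rfl)
  le_trans x y z hxy hyz := by
    obtain ⟨a, rfl⟩ := mk_surjective γ x
    obtain ⟨b, rfl⟩ := mk_surjective γ y
    obtain ⟨c, rfl⟩ := mk_surjective γ z
    rcases mk_le_mk.1 hxy with h₁ | h₁
    · rcases mk_le_mk.1 hyz with h₂ | h₂
      · exact mk_le_mk.2 (Or.inl (h₁.trans h₂))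
      · rwa [← h₂]
    · rwa [h₁]
  le_antisymm x y hxy hyx := by
    obtain ⟨a, rfl⟩ := mk_surjective γ x
    obtain ⟨b, rfl⟩ := mk_surjective γ y
    rcases mk_le_mk.1 hxy with h₁ | h₁
    · rcases mk_le_mk.1 hyx with h₂ | h₂
      · rw [le_antisymm h₁ h₂]
      · exact h₂.symm
    · exact h₁
  le_total x y := by
    obtain ⟨a, rfl⟩ := mk_surjective γ x
    obtain ⟨b, rfl⟩ := mk_surjective γ y
    exact (le_total a b).imp (fun h => mk_le_mk.2 (Or.inl h)) (fun h => mk_le_mk.2 (Or.inl h))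
  toDecidableLE := Classical.decRel _

instance {G : Type*} [AddCommGroup G] [LinearOrder G] [IsOrderedAddMonoid G]
    (γ : G) : IsOrderedAddMonoid (ArchComponent γ) where
  add_le_add_left x y hxy z := by
    obtain ⟨a, b, rfl, rfl, hab⟩ := hxy
    obtain ⟨c, rfl⟩ := mk_surjective γ z
    rw [← map_add, ← map_add]
    exact mk_le_mk.2 (Or.inl (by gcongr))

end ArchComponent

/-- An ordered abelian group is discretely ordered if every element has an immediate successor. -/
def IsDiscretelyOrdered (G : Type*) [AddCommGroup G] [LinearOrder G] : Prop :=
  ∀ x : G, ∃ y : G, x ⋖ y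

/-! ### Valued fields

`v : AddValuation F (WithTop Γ)` is a Krull valuation, written additively, with values in an
ordered abelian group `Γ` (not assumed to be attained) and with `v x = ⊤` only for `x = 0`. For an
extension `L | K` and a valuation `v` of `L`, the field `K` carries the restriction
`restrictVal K v` of `v`. -/

section Valued

variable {F Γ : Type*} [Field F] [AddCommGroup Γ] [LinearOrder Γ] [IsOrderedAddMonoid Γ]

/-- The valuation ring `O_F = {x | 0 ≤ v x}`. -/
def valRing (v : AddValuation F (WithTop Γ)) : ValuationSubring F where
  carrier := {x | 0 ≤ v x}
  mul_mem' {a b} ha hb := by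
    simp only [Set.mem_ofPred_eq, v.map_mul] at *
    exact add_nonneg ha hb
  one_mem' := by simp
  add_mem' {a b} ha hb := (le_min ha hb).trans (v.map_add a b)
  zero_mem' := by simp
  neg_mem' {a} ha := by simpa using ha
  mem_or_inv_mem' x := by
    by_cases hx : x = 0
    · left; simp [hx]
    · rcases le_total 0 (v x) with h | h
      · exact Or.inl h
      · right
        have h1 : v x + v x⁻¹ = 0 := by rw [← v.map_mul, mul_inv_cancel₀ hx, v.map_one]
        by_contra hlt
        simp only [Set.mem_ofPred_eq, not_le] at hlt
        have h2 : v x + v x⁻¹ < 0 := by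
          calc v x + v x⁻¹ ≤ 0 + v x⁻¹ := by gcongr
            _ = v x⁻¹ := zero_add _
            _ < 0 := hlt
        exact absurd h1 h2.ne

theorem mem_valRing {v : AddValuation F (WithTop Γ)} {x : F} : x ∈ valRing v ↔ 0 ≤ v x := Iff.rfl

/-- The value group `vF` of a valued field `(F, v)`. -/
def valGroup (v : AddValuation F (WithTop Γ)) : AddSubgroup Γ where
  carrier := {γ | ∃ x : F, v x = (γ : WithTop Γ)}
  zero_mem' := ⟨1, by simp⟩
  add_mem' := by
    rintro a b ⟨x, hx⟩ ⟨y, hy⟩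
    exact ⟨x * y, by rw [v.map_mul, hx, hy, WithTop.coe_add]⟩
  neg_mem' := by
    rintro a ⟨x, hx⟩
    have hx0 : x ≠ 0 := by
      rintro rfl
      rw [v.map_zero] at hx
      exact WithTop.top_ne_coe hx
    refine ⟨x⁻¹, ?_⟩
    have h1 : v x + v x⁻¹ = 0 := by rw [← v.map_mul, mul_inv_cancel₀ hx0, v.map_one]
    cases h : v x⁻¹ with
    | top => rw [h, hx] at h1; simp at h1
    | coe b =>
      rw [h, hx, ← WithTop.coe_add] at h1
      have h2 : a + b = 0 := by exact_mod_cast h1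
      rw [eq_neg_of_add_eq_zero_right h2]

/-- The value of `x ≠ 0` as an element of the value group (and `0` for `x = 0`). -/
def val (v : AddValuation F (WithTop Γ)) (x : F) : valGroup v :=
  ⟨(v x).untopD 0, by
    cases h : v x with
    | top => exact (valGroup v).zero_mem
    | coe a => exact ⟨x, h⟩⟩

theorem coe_val (v : AddValuation F (WithTop Γ)) {x : F} (hx : x ≠ 0) :
    (((val v x : valGroup v) : Γ) : WithTop Γ) = v x := by
  have h1 : v x + v x⁻¹ = 0 := by rw [← v.map_mul, mul_inv_cancel₀ hx, v.map_one]
  cases h : v x with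
  | top => rw [h] at h1; simp at h1
  | coe a => simp [val, h]

/-- The set `vI` of the values of the nonzero elements of an ideal `I` of `O_F`. -/
def valSet (v : AddValuation F (WithTop Γ)) (I : Ideal (valRing v)) : Set (valGroup v) :=
  {γ | ∃ x ∈ I, (x : F) ≠ 0 ∧ val v (x : F) = γ}

/-- A `1`-unit is an element of the form `1 + b` with `v b > 0`. -/
def IsOneUnit (v : AddValuation F (WithTop Γ)) (u : F) : Prop := 0 < v (u - 1)

end Valued

section Extension

variable {L Γ : Type*} [Field L] [AddCommGroup Γ] [LinearOrder Γ] [IsOrderedAddMonoid Γ]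

/-- The restriction to `K` of a valuation of an extension field `L` of `K`. -/
def restrictVal (K : Type*) [Field K] [Algebra K L] (v : AddValuation L (WithTop Γ)) :
    AddValuation K (WithTop Γ) :=
  v.comap (algebraMap K L)

variable {K : Type*} [Field K] [Algebra K L]

theorem restrictVal_apply (v : AddValuation L (WithTop Γ)) (x : K) :
    restrictVal K v x = v (algebraMap K L x) := rfl

/-- `O_L` is an algebra over `O_K` by means of the inclusion. -/
noncomputable instance valRingAlgebra (v : AddValuation L (WithTop Γ)) :
    Algebra (valRing (restrictVal K v)) (valRing v) :=
  RingHom.toAlgebra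
    { toFun := fun x => ⟨algebraMap K L x, x.2⟩
      map_one' := by ext; simp
      map_mul' := fun x y => by ext; simp
      map_zero' := by ext; simp
      map_add' := fun x y => by ext; simp }

theorem coe_algebraMap_valRing (v : AddValuation L (WithTop Γ)) (x : valRing (restrictVal K v)) :
    ((algebraMap (valRing (restrictVal K v)) (valRing v) x : valRing v) : L)
      = algebraMap K L (x : K) := rfl

/-- `L | K` is a Kummer extension of prime degree `q`: a Galois extension of degree `q` of a field
containing all `q`-th roots of unity, where `q` is not the characteristic. -/
structure IsKummerExtension (K L : Type*) [Field K] [Field L] [Algebra K L] (q : ℕ) : Prop where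
  exists_root : ∃ ζ : K, IsPrimitiveRoot ζ q
  isGalois : IsGalois K L
  finrank_eq : Module.finrank K L = q

/-- A Kummer generator of an extension `L | K` of degree `q`. -/
def IsKummerGenerator (K : Type*) {L : Type*} [Field K] [Field L] [Algebra K L]
    (q : ℕ) (η : L) : Prop :=
  IntermediateField.adjoin K {η} = ⊤ ∧ ∃ a : K, algebraMap K L a = η ^ q

/-- The ring `O_L` is the union of its subrings `O_K[c x]`, where `c` runs through the nonzero
elements of `K` with `v(c x) > 0`. -/
def GeneratesValRing (K : Type*) [Field K] [Algebra K L] (v : AddValuation L (WithTop Γ))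
    (x : L) : Prop :=
  (valRing v : Set L) = ⋃ c ∈ {c : K | c ≠ 0 ∧ 0 < v (algebraMap K L c * x)},
    (Algebra.adjoin (valRing (restrictVal K v)) {algebraMap K L c * x} : Set L)

/-- Case (i): `η` is a Kummer generator with `v η < 0`, and `O_L` is the union of the rings
`O_K[c η]` with `c ∈ K^×`, `v(c η) > 0`. -/
structure KummerCaseI (K : Type*) [Field K] [Algebra K L] (v : AddValuation L (WithTop Γ))
    (q : ℕ) (η : L) : Prop where
  generator : IsKummerGenerator K q η
  neg : v η < 0
  generates : GeneratesValRing K v η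

/-- The ideal `I = (c η ∣ c ∈ K, v(c η) > 0)` of `O_L`. -/
def kummerIdealI (K : Type*) [Field K] [Algebra K L] (v : AddValuation L (WithTop Γ))
    (η : L) : Ideal (valRing v) :=
  Ideal.span {x | ∃ c : K, 0 < v (algebraMap K L c * η) ∧ (x : L) = algebraMap K L c * η}

/-- The element `ξ = (η - 1) / (1 - ζ)`. -/
noncomputable def kummerXi (ζ : K) (η : L) : L := (η - 1) / (1 - algebraMap K L ζ)

/-- Case (ii), for a primitive `q`-th root of unity `ζ ∈ K`: here `char K = 0` and `char Kv = q`,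
the Kummer generator `η` is a `1`-unit, `1 ≤ j ≤ q - 1`, and for `ξ = (η - 1) / (1 - ζ)` we have
`v ξ < 0`, and `O_L` is the union of the rings `O_K[c ξ^j]` with `c ∈ K^×`, `v(c ξ^j) > 0`. -/
structure KummerCaseII (v : AddValuation L (WithTop Γ)) (q : ℕ) (ζ : K) (η : L) (j : ℕ) :
    Prop where
  charZero : CharZero K
  residueChar : CharP (IsLocalRing.ResidueField (valRing (restrictVal K v))) q
  generator : IsKummerGenerator K q η
  oneUnit : IsOneUnit v η
  one_le : 1 ≤ j
  le_pred : j ≤ q - 1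
  neg : v (kummerXi ζ η) < 0
  generates : GeneratesValRing K v (kummerXi ζ η ^ j)

/-- The ideal `I = (c ξ^(j-1) ∣ c ∈ K^×, v(c ξ^j) > 0)` of `O_L`. -/
def kummerIdealII (v : AddValuation L (WithTop Γ)) (ζ : K) (η : L) (j : ℕ) :
    Ideal (valRing v) :=
  Ideal.span {x | ∃ c : K, c ≠ 0 ∧ 0 < v (algebraMap K L c * kummerXi ζ η ^ j) ∧
    (x : L) = algebraMap K L c * kummerXi ζ η ^ (j - 1)}

end Extension

/-! ### Convex subgroups and archimedean components through multiples of elements. -/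

section OrderedGroups

variable {G : Type*} [AddCommGroup G] [LinearOrder G] [IsOrderedAddMonoid G]

/-! Since `(vL : vK) = q = [L : K]`, every `x` with `v x ∉ vK` gives a `K`-basis `1, x, …, x ^ (q -
1)` whose multiples have values in different cosets of `vK`, so a sum takes the minimum of the
values of its terms (`addVal_sum_mul_pow_le`). Hence `v` is Galois invariant (`addVal_algEquiv`),
`O_L` is integral over `O_K`, and `∑ a_i x ^ i` lies in `O_L` only if each term does. So `O_L` is
the union of the rings `O_K[c x]` once the coset of `v x` has small enough positive elements. Some
coset does (`exists_coset_small`), and since `v x` generates `vL / vK`, a power `x ^ j` with `1 ≤ j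
< q` has its value there.

A Kummer generator with value outside `vK` thus yields case (i); if `v q = 0`, a Lagrange resolvent
is one. If `v q > 0` and the generator has value in `vK`, it is normalized to a `1`-unit with `v (η
- 1) ∉ vK`. The conjugates of `ξ` differ from it by units, which forces `v ξ < 0` and gives case
(ii).

For the differentials, `O_L` is the union of a chain of rings `O_K[θ_i]`. So `Ω` is generated by the
`dθ_i`, with relations `h_i'(θ_i) dθ_i = 0` from the minimal polynomials `h_i`, and `dθ_i = r dθ_j`
when `θ_i = r θ_j`. Weights `g_i` scaling like the `θ_i` turn this into `Ω ≅ I / N`, with `I`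
generated by the `g_i` and `N` by the `g_i h_i'(θ_i)` (`nonempty_kaehlerDifferential_equiv`). In
case (i) `θ = g = c η` and `g h'(θ) = q g ^ q`. In case (ii) `θ = c ξ ^ j`, `g = c ξ ^ (j - 1)`, and
`g h'(θ)` has the value of `g ^ q`.

Vanishing means `I ⊆ N`. In case (i) this says that each positive `β` in the coset of `v η` admits a
positive `β'` there with `v q + q β' ≤ β`; `exists_small_of_forall_exists_coset` and
`forall_exists_coset_of_small` relate this to archimedean components. In case (ii) all values of `I
^ q` exceed `-q v ξ`, while `I` has an element of value at most `-q v ξ`. -/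

theorem mem_convexC_iff {γ x : G} : x ∈ convexC γ ↔ ∃ n : ℕ, |x| ≤ n • |γ| := by
  let H : AddSubgroup G :=
    { carrier := {x | ∃ n : ℕ, |x| ≤ n • |γ|}
      zero_mem' := ⟨0, by simp⟩
      add_mem' := by
        rintro a b ⟨n, hn⟩ ⟨m, hm⟩
        exact ⟨n + m, (abs_add_le a b).trans (by rw [add_nsmul]; gcongr)⟩
      neg_mem' := by
        rintro a ⟨n, hn⟩
        exact ⟨n, by rwa [abs_neg]⟩ }
  constructor
  · intro hx
    refine (convexC_isLeast γ).2 (show H ∈ _ from ⟨?_, 1, by simp⟩) hx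
    rintro a ⟨n, hn⟩ b ⟨m, hm⟩ y hay hyb
    refine ⟨n + m, (abs_le_max_abs_abs hay hyb).trans (max_le ?_ ?_)⟩
    · exact hn.trans (nsmul_le_nsmul_left (abs_nonneg _) (by omega))
    · exact hm.trans (nsmul_le_nsmul_left (abs_nonneg _) (by omega))
  · rintro ⟨n, hn⟩
    have h1 : |γ| ∈ convexC γ := by
      rcases abs_choice γ with h | h <;> rw [h]
      · exact (convexC_isLeast γ).1.2
      · exact neg_mem (convexC_isLeast γ).1.2
    exact (convexC_isLeast γ).1.1 _ (neg_mem (nsmul_mem h1 n)) _ (nsmul_mem h1 n) x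
      (abs_le.1 hn).1 (abs_le.1 hn).2

/-- A convex subgroup missing `γ` can contain `x` exactly when `γ ∉ C(x)`, that is, when `x` is
infinitesimal compared with `γ`. -/
theorem mem_convexCPlus_iff {γ x : G} (hγ : γ ≠ 0) :
    x ∈ convexCPlus γ ↔ ∀ n : ℕ, n • |x| < |γ| := by
  have h : x ∈ convexCPlus γ ↔ γ ∉ convexC x := by
    refine ⟨fun hx hc => ?_, fun hc => ?_⟩
    · exact (convexCPlus_isGreatest hγ).1.2
        ((convexC_isLeast x).2 ⟨(convexCPlus_isGreatest hγ).1.1, hx⟩ hc)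
    · exact (convexCPlus_isGreatest hγ).2 ⟨(convexC_isLeast x).1.1, hc⟩ (convexC_isLeast x).1.2
  rw [h, mem_convexC_iff]
  push Not
  rfl

theorem ArchComponent.mk_pos_iff {γ : G} (hγ : γ ≠ 0) {a : convexC γ} (ha : 0 ≤ (a : G)) :
    0 < mk γ a ↔ ∃ n : ℕ, |γ| ≤ n • (a : G) := by
  have h0 : (0 : ArchComponent γ) ≤ mk γ a := by
    rw [← map_zero (mk γ)]
    exact mk_le_mk.2 (Or.inl ha)
  have h1 : mk γ a = 0 ↔ (a : G) ∈ convexCPlus γ := by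
    rw [eq_comm, ← map_zero (mk γ), mk_eq_mk]
    simp
  rw [lt_iff_le_and_ne, and_iff_right h0, ne_comm, Ne, h1, mem_convexCPlus_iff hγ, abs_of_nonneg ha]
  push Not
  rfl

/-- The archimedean component of a positive `δ` is discrete if and only if it does not contain
arbitrarily small positive elements. -/
theorem not_isDiscretelyOrdered_archComponent_iff {δ : G} (hδ : 0 < δ) :
    ¬ IsDiscretelyOrdered (ArchComponent δ) ↔
      ∀ N : ℕ, ∃ h : G, 0 < h ∧ N • h ≤ δ ∧ ∃ m : ℕ, δ ≤ m • h := by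
  have mem_of : ∀ h : G, 0 ≤ h → h ≤ δ → h ∈ convexC δ := fun h h0 h1 =>
    mem_convexC_iff.2 ⟨1, by simpa [abs_of_nonneg h0, abs_of_pos hδ] using h1⟩
  constructor
  · intro hd
    -- there is no least positive element
    have hno : ∀ x : ArchComponent δ, 0 < x → ∃ y, 0 < y ∧ y < x := by
      intro x hx
      by_contra! hcon
      refine hd fun z => ⟨z + x, by simpa using hx, fun w hw1 hw2 => ?_⟩
      have h1 := hcon (w - z) (sub_pos.2 hw1)
      exact absurd (sub_lt_iff_lt_add'.2 hw2) (not_lt.2 h1)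
    -- One of `y` and `x - y` is at most half of `x`.
    have hhalf : ∀ x : ArchComponent δ, 0 < x → ∃ y, 0 < y ∧ 2 • y ≤ x := by
      intro x hx
      obtain ⟨y, hy0, hyx⟩ := hno x hx
      rcases le_total (2 • y) x with h | h
      · exact ⟨y, hy0, h⟩
      · exact ⟨x - y, sub_pos.2 hyx, by grind⟩
    have hpow : ∀ n : ℕ, ∀ x : ArchComponent δ, 0 < x → ∃ y, 0 < y ∧ (2 ^ n) • y ≤ x := by
      intro n
      induction n with
      | zero => exact fun x hx => ⟨x, hx, by simp⟩
      | succ n ih =>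
        intro x hx
        obtain ⟨y, hy, hyx⟩ := ih x hx
        obtain ⟨z, hz, hzy⟩ := hhalf y hy
        refine ⟨z, hz, ?_⟩
        rw [pow_succ, mul_nsmul']
        exact (nsmul_le_nsmul_right hzy _).trans hyx
    intro N
    have hδm : δ ∈ convexC δ := (convexC_isLeast δ).1.2
    have hpos : 0 < ArchComponent.mk δ ⟨δ, hδm⟩ :=
      (ArchComponent.mk_pos_iff hδ.ne' hδ.le).2 ⟨1, by simp [abs_of_pos hδ]⟩
    -- One extra halving pays for the lift to `G`: an inequality of classes lifts only up to an
    -- infinitesimal, giving `2 • δ` instead of `δ` as bound.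
    obtain ⟨y, hy0, hy⟩ := hpow (N + 1) _ hpos
    obtain ⟨a, rfl⟩ := ArchComponent.mk_surjective δ y
    have ha0 : 0 < (a : G) := by
      by_contra! hcon
      refine absurd hy0 (not_lt.2 ?_)
      rw [← map_zero (ArchComponent.mk δ)]
      exact ArchComponent.mk_le_mk.2 (Or.inl hcon)
    have ham := (ArchComponent.mk_pos_iff hδ.ne' ha0.le).1 hy0
    refine ⟨a, ha0, ?_, by simpa [abs_of_pos hδ] using ham⟩
    rw [← map_nsmul] at hy
    have h2 : (2 ^ (N + 1)) • (a : G) ≤ 2 • δ := by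
      rcases ArchComponent.mk_le_mk.1 hy with h | h
      · have h' : (2 ^ (N + 1)) • (a : G) ≤ δ := h
        grind
      · rw [ArchComponent.mk_eq_mk, mem_convexCPlus_iff hδ.ne'] at h
        have h1 := h 1
        rw [one_nsmul, abs_of_pos hδ] at h1
        have h3 := (abs_lt.1 h1).1
        have h4 : -δ < δ - (2 ^ (N + 1)) • (a : G) := h3
        rw [two_nsmul]
        exact (sub_lt_iff_lt_add.1 (by simpa using neg_lt_neg h4)).le
    rw [pow_succ, mul_nsmul] at h2
    have h3 : N • (a : G) ≤ (2 ^ N) • (a : G) :=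
      nsmul_le_nsmul_left ha0.le Nat.lt_two_pow_self.le
    rw [nsmul_le_nsmul_iff_right two_ne_zero] at h2
    exact h3.trans h2
  · intro h hd
    obtain ⟨y, hy⟩ := hd 0
    obtain ⟨g, rfl⟩ := ArchComponent.mk_surjective δ y
    have hg0 : 0 < (g : G) := by
      by_contra! hcon
      refine absurd hy.1 (not_lt.2 ?_)
      rw [← map_zero (ArchComponent.mk δ)]
      exact ArchComponent.mk_le_mk.2 (Or.inl hcon)
    obtain ⟨m, hm⟩ := (ArchComponent.mk_pos_iff hδ.ne' hg0.le).1 hy.1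
    rw [abs_of_pos hδ] at hm
    -- As `δ ≤ m g`, the factor `2 m` forces `2 e ≤ g`, so the class of `e` lies strictly between
    -- `0` and its successor. The `+ 1` yields `e ≤ δ` whatever `m` is.
    obtain ⟨e, he0, hNe, k, hk⟩ := h (m * 2 + 1)
    have heδ : e ≤ δ := by
      refine le_trans ?_ hNe
      simpa using nsmul_le_nsmul_left he0.le (show 1 ≤ m * 2 + 1 by omega)
    have hm0 : m ≠ 0 := by
      rintro rfl
      rw [zero_nsmul] at hm
      exact absurd hδ (not_lt.2 hm)
    have h2 : 2 • e ≤ (g : G) := by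
      by_contra! hcon
      have h3 : m • (g : G) < m • (2 • e) := nsmul_lt_nsmul_right hm0 hcon
      rw [← mul_nsmul'] at h3
      rw [add_nsmul, one_nsmul] at hNe
      grind
    set e' : convexC δ := ⟨e, mem_of e he0.le heδ⟩
    have he'0 : 0 < ArchComponent.mk δ e' :=
      (ArchComponent.mk_pos_iff hδ.ne' he0.le).2 ⟨k, by rwa [abs_of_pos hδ]⟩
    refine hy.2 he'0 ?_
    have h3 : ArchComponent.mk δ (2 • e') ≤ ArchComponent.mk δ g :=
      ArchComponent.mk_le_mk.2 (Or.inl h2)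
    rw [map_nsmul] at h3
    grind

end OrderedGroups

/-! ### Cosets of a subgroup of prime index. -/

section PrimeIndex

variable {G : Type*} [AddCommGroup G] {H : AddSubgroup G} {q : ℕ}

theorem nsmul_mem_of_index_eq (h : H.index = q) (g : G) : q • g ∈ H :=
  h ▸ H.nsmul_index_mem g

/-- Bézout: `i` is invertible modulo `q`, and `q` annihilates `G / H`. -/
theorem mem_of_nsmul_mem_of_index_prime (hq : q.Prime) (h : H.index = q) {g : G} {i : ℕ}
    (hi0 : 0 < i) (hi : i < q) (hg : i • g ∈ H) : g ∈ H := by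
  have hc : Nat.Coprime i q :=
    ((Nat.Prime.coprime_iff_not_dvd hq).2 (Nat.not_dvd_of_pos_of_lt hi0 hi)).symm
  have hb := Nat.gcd_eq_gcd_ab i q
  rw [hc] at hb
  have : g = (Nat.gcdA i q) • (i • g) + (Nat.gcdB i q) • (q • g) := by
    rw [← natCast_zsmul g i, ← natCast_zsmul g q, ← mul_zsmul, ← mul_zsmul, ← add_zsmul,
      ← mul_comm (i : ℤ), ← mul_comm (q : ℤ), ← hb]
    simp
  rw [this]
  exact add_mem (zsmul_mem hg _) (zsmul_mem (nsmul_mem_of_index_eq h g) _)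

theorem exists_nsmul_sub_mem_of_index_prime (hq : q.Prime) (h : H.index = q) {g : G}
    (hg : g ∉ H) (γ : G) : ∃ j < q, j • g - γ ∈ H := by
  have := Fact.mk hq
  have hcard : Nat.card (G ⧸ H) = q := h
  have h0 : (g : G ⧸ H) ≠ 0 := by rwa [Ne, QuotientAddGroup.eq_zero_iff]
  have hm : (γ : G ⧸ H) ∈ AddSubgroup.zmultiples (g : G ⧸ H) :=
    mem_zmultiples_of_prime_card hcard h0
  obtain ⟨k, hk⟩ := AddSubgroup.mem_zmultiples_iff.1 hm
  have hqz : (0 : ℤ) < q := by exact_mod_cast hq.pos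
  refine ⟨(k % q).toNat, ?_, ?_⟩
  · have := Int.emod_lt_of_pos k hqz
    have := Int.emod_nonneg k hqz.ne'
    omega
  · have h1 : k • g - γ ∈ H := by
      rw [← QuotientAddGroup.eq_zero_iff]
      rw [QuotientAddGroup.mk_sub, QuotientAddGroup.mk_zsmul, hk, sub_self]
    have h2 : (k % q).toNat • g - γ = (k • g - γ) - (k / q) • (q • g) := by
      rw [← natCast_zsmul g (Int.toNat _), Int.toNat_of_nonneg (Int.emod_nonneg k hqz.ne'),
        ← natCast_zsmul g q, ← mul_zsmul', Int.emod_def, sub_zsmul]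
      abel
    rw [h2]
    exact sub_mem h1 (zsmul_mem (nsmul_mem_of_index_eq h g) _)

end PrimeIndex

/-! ### Small positive elements in cosets of a subgroup of prime index. -/

section PrimeIndexOrder

variable {G : Type*} [AddCommGroup G] [LinearOrder G] [IsOrderedAddMonoid G]
  {H : AddSubgroup G} {q : ℕ}

theorem exists_pos_notMem (hq : q.Prime) (h : H.index = q) : ∃ α : G, 0 < α ∧ α ∉ H := by
  have hne : H ≠ ⊤ := by
    rintro rfl
    rw [AddSubgroup.index_top] at h
    exact hq.one_lt.ne h
  obtain ⟨g, hg⟩ : ∃ g, g ∉ H := by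
    by_contra! hcon
    exact hne (eq_top_iff.2 fun x _ => hcon x)
  have hg0 : g ≠ 0 := fun h0 => hg (h0 ▸ zero_mem H)
  refine ⟨|g|, abs_pos.2 hg0, ?_⟩
  rcases abs_choice g with h | h <;> rw [h]
  · exact hg
  · rwa [neg_mem_iff]

/-- Shrinking by the factor `q` twice pays for two multiplications: by the `j < q` that moves `β`
into the coset of `π`, and by `i`. -/
theorem exists_small_in_coset_of_forall_exists (hq : q.Prime) (h : H.index = q)
    (hsmall : ∀ α : G, 0 < α → α ∉ H → ∃ β : G, 0 < β ∧ β ∉ H ∧ q • β ≤ α)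
    {π : G} (hπ : π ∉ H) {i : ℕ} (hi : i < q) {α : G} (hα : 0 < α) (hαH : α ∉ H) :
    ∃ β : G, 0 < β ∧ β - π ∈ H ∧ i • β ≤ α := by
  obtain ⟨β₁, h1, h1H, hβ₁⟩ := hsmall α hα hαH
  obtain ⟨β, h2, h2H, hβ⟩ := hsmall β₁ h1 h1H
  obtain ⟨j, hj, hjπ⟩ := exists_nsmul_sub_mem_of_index_prime hq h h2H π
  have hj0 : j ≠ 0 := by
    rintro rfl
    rw [zero_nsmul, zero_sub, neg_mem_iff] at hjπ
    exact hπ hjπ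
  refine ⟨j • β, nsmul_pos h2 hj0, hjπ, ?_⟩
  calc i • j • β ≤ i • q • β := by gcongr
    _ ≤ i • β₁ := by gcongr
    _ ≤ q • β₁ := by gcongr
    _ ≤ α := hβ₁

/-- Such a `δ` is infinitesimal against `α₀`: if `m δ < α₀ ≤ (m + 1) δ`, then `α₀ - m δ` is
positive, outside `H` and at most `δ`, so `q` times it is at most `α₀`, against `hlarge`. -/
theorem nsmul_lt_of_nsmul_le {α₀ : G} (hα₀ : 0 < α₀) (hα₀H : α₀ ∉ H)
    (hlarge : ∀ β : G, 0 < β → β ∉ H → α₀ < q • β) {δ : G} (hδ : 0 ≤ δ) (hqδ : q • δ ≤ α₀)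
    (m : ℕ) : δ ∈ H ∧ m • δ < α₀ := by
  have hδH : δ ∈ H := by
    by_contra hcon
    have h0 : δ ≠ 0 := fun h0 => hcon (h0 ▸ zero_mem H)
    exact absurd hqδ (not_le.2 (hlarge δ (lt_of_le_of_ne hδ h0.symm) hcon))
  refine ⟨hδH, ?_⟩
  induction m with
  | zero => simpa using hα₀
  | succ m ih =>
    by_contra! hcon
    have h1 : α₀ - m • δ ∉ H := fun hmem => hα₀H (by simpa using add_mem hmem (nsmul_mem hδH m))
    have h2 := hlarge _ (sub_pos.2 ih) h1
    have h3 : α₀ - m • δ ≤ δ := by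
      rw [succ_nsmul] at hcon
      grind
    exact absurd (h2.trans_le (nsmul_le_nsmul_right h3 q)) (not_lt.2 hqδ)

/-- Otherwise one descends from `α₀`, each step lowering `q β` by more than `α₀`. Starting at `q
α₀`, this cannot be done `q + 1` times with `β` positive. -/
theorem exists_minimal_of_large {α₀ : G} (hα₀ : 0 < α₀) (hα₀H : α₀ ∉ H) :
    ∃ π : G, 0 < π ∧ π ∉ H ∧ ∀ β : G, 0 < β → β ∉ H → q • (π - β) ≤ α₀ := by
  by_contra! hcon
  have key : ∀ n : ℕ, ∃ β : G, 0 < β ∧ β ∉ H ∧ q • β + n • α₀ ≤ q • α₀ := by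
    intro n
    induction n with
    | zero => exact ⟨α₀, hα₀, hα₀H, by simp⟩
    | succ n ih =>
      obtain ⟨β, h0, hH, hle⟩ := ih
      obtain ⟨β', h0', hH', hlt⟩ := hcon β h0 hH
      refine ⟨β', h0', hH', ?_⟩
      rw [nsmul_sub] at hlt
      rw [succ_nsmul]
      grind
  obtain ⟨β, h0, hH, hle⟩ := key (q + 1)
  rw [succ_nsmul] at hle
  have : 0 ≤ q • β := nsmul_nonneg h0.le q
  grind

/-- Some coset of a subgroup `H` of prime index has arbitrarily small positive elements, as
compared with the positive elements of its multiples. -/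
theorem exists_coset_small (hq : q.Prime) (h : H.index = q) :
    ∃ π : G, π ∉ H ∧ ∀ i : ℕ, 0 < i → i < q → ∀ α : G, 0 < α → α - i • π ∈ H →
      ∃ β : G, 0 < β ∧ β - π ∈ H ∧ i • β ≤ α := by
  have hnot : ∀ π : G, π ∉ H → ∀ i : ℕ, 0 < i → i < q → ∀ α : G, α - i • π ∈ H → α ∉ H := by
    intro π hπ i hi0 hi α hα hαH
    refine hπ (mem_of_nsmul_mem_of_index_prime hq h hi0 hi ?_)
    simpa using sub_mem hαH hα
  by_cases hsmall : ∀ α : G, 0 < α → α ∉ H → ∃ β : G, 0 < β ∧ β ∉ H ∧ q • β ≤ α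
  · obtain ⟨π, -, hπ⟩ := exists_pos_notMem hq h
    exact ⟨π, hπ, fun i hi0 hi α hα hαi =>
      exists_small_in_coset_of_forall_exists hq h hsmall hπ hi hα (hnot π hπ i hi0 hi α hαi)⟩
  push Not at hsmall
  obtain ⟨α₀, hα₀, hα₀H, hlarge⟩ := hsmall
  obtain ⟨π, hπ0, hπ, hmin⟩ := exists_minimal_of_large (q := q) hα₀ hα₀H
  refine ⟨π, hπ, fun i hi0 hi α hα hαi => ?_⟩
  -- Elements infinitesimal against `α₀` are so against `π` too, because `α₀ < q π`.
  have hinf : ∀ δ : G, 0 ≤ δ → q • δ ≤ α₀ → δ ∈ H ∧ ∀ m : ℕ, m • δ < π := by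
    intro δ hδ hδq
    refine ⟨(nsmul_lt_of_nsmul_le hα₀ hα₀H hlarge hδ hδq 0).1, fun m => ?_⟩
    have h1 := (nsmul_lt_of_nsmul_le hα₀ hα₀H hlarge hδ hδq (q * m)).2
    rw [mul_nsmul'] at h1
    exact lt_of_nsmul_lt_nsmul_right q (h1.trans (hlarge π hπ0 hπ))
  by_cases hbig : i • π ≤ α
  · exact ⟨π, hπ0, by simp, hbig⟩
  -- `α = m π + r` with `m < i` and `0 ≤ r < π`
  obtain ⟨m, hm1, hm2⟩ : ∃ m : ℕ, m • π ≤ α ∧ α < (m + 1) • π := by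
    classical
    have hex : ∃ n : ℕ, α < n • π := ⟨i, not_le.1 hbig⟩
    have hn := Nat.find_spec hex
    have hn0 : Nat.find hex ≠ 0 := by
      intro h0
      rw [h0, zero_nsmul] at hn
      exact absurd hα (not_lt.2 hn.le)
    refine ⟨Nat.find hex - 1, ?_, ?_⟩
    · exact not_lt.1 (Nat.find_min hex (by omega))
    · rwa [Nat.sub_add_cancel (by omega)]
  have hmi : m < i := by
    by_contra! hcon
    exact hbig ((nsmul_le_nsmul_left hπ0.le hcon).trans hm1)
  rw [succ_nsmul] at hm2
  set r := α - m • π with hr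
  have hr0 : 0 ≤ r := by grind
  have hrH : r ∉ H := by
    intro hrH
    have h1 : (i - m) • π ∈ H := by
      have : (i - m) • π = r - (α - i • π) := by
        rw [sub_nsmul _ hmi.le, hr]; abel
      rw [this]
      exact sub_mem hrH hαi
    exact hπ (mem_of_nsmul_mem_of_index_prime hq h (by omega) (by omega) h1)
  have hrpos : 0 < r := lt_of_le_of_ne hr0 fun h0 => hrH (h0 ▸ zero_mem H)
  obtain ⟨hδH, hδ⟩ := hinf (π - r) (by grind) (hmin r hrpos hrH)
  -- so `α = (m + 1) π - δ` with `δ ∈ H`, hence `m + 1 = i`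
  have hmi' : m + 1 = i := by
    by_contra hne
    have h1 : (i - (m + 1)) • π ∈ H := by
      have : (i - (m + 1)) • π = -(π - r) - (α - i • π) := by
        rw [sub_nsmul _ (by omega : m + 1 ≤ i), succ_nsmul, hr]; abel
      rw [this]
      exact sub_mem (neg_mem hδH) hαi
    exact hπ (mem_of_nsmul_mem_of_index_prime hq h (by omega) (by omega) h1)
  have h1 := hδ 1
  refine ⟨r, hrpos, by simpa using neg_mem hδH, ?_⟩
  -- Here `i r = m r + r ≤ m π + r = α`.
  rw [← hmi', succ_nsmul]
  have h2 : m • r ≤ m • π := nsmul_le_nsmul_right (by grind) m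
  grind

end PrimeIndexOrder

/-! ### The condition `t + q β' ≤ β` on a coset, in archimedean terms. -/

section CosetCriterion

variable {G : Type*} [AddCommGroup G] [LinearOrder G] [IsOrderedAddMonoid G]
  {H : AddSubgroup G} {q : ℕ} {γ t : G}

/-- The hypothesis applies again to `β'`, and `β' ≤ q β'`, so every iteration removes one more `t`
from `β`. -/
theorem nsmul_lt_of_forall_exists_coset (hq : 1 ≤ q)
    (hA : ∀ β : G, 0 < β → β - γ ∈ H → ∃ β' : G, 0 < β' ∧ β' - γ ∈ H ∧ t + q • β' ≤ β)
    (n : ℕ) {β : G} (hβ : 0 < β) (hβγ : β - γ ∈ H) : n • t < β := by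
  induction n generalizing β with
  | zero => simpa using hβ
  | succ n ih =>
    obtain ⟨β', h1, h2, h3⟩ := hA β hβ hβγ
    have h4 := ih h1 h2
    have h5 : β' ≤ q • β' := by simpa using nsmul_le_nsmul_left h1.le hq
    rw [succ_nsmul]
    grind

theorem exists_pow_nsmul_le_of_forall_exists_coset (ht : 0 ≤ t)
    (hA : ∀ β : G, 0 < β → β - γ ∈ H → ∃ β' : G, 0 < β' ∧ β' - γ ∈ H ∧ t + q • β' ≤ β)
    (n : ℕ) {β : G} (hβ : 0 < β) (hβγ : β - γ ∈ H) :
    ∃ β' : G, 0 < β' ∧ β' - γ ∈ H ∧ (q ^ n) • β' ≤ β := by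
  induction n with
  | zero => exact ⟨β, hβ, hβγ, by simp⟩
  | succ n ih =>
    obtain ⟨β', h1, h2, h3⟩ := ih
    obtain ⟨β'', h4, h5, h6⟩ := hA β' h1 h2
    refine ⟨β'', h4, h5, le_trans ?_ h3⟩
    rw [pow_succ, mul_nsmul']
    exact nsmul_le_nsmul_right ((le_add_of_nonneg_left ht).trans h6) _

/-- Differences of coset elements lie in `H`. With `q ^ N β₁ ≤ β` and `t + q β₂ ≤ β₁`, the
difference `β₁ - β₂` is at most `β₁`, hence small, and at least `β₂`, hence archimedean comparable
to `β`. -/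
theorem exists_small_of_forall_exists_coset (hq : 2 ≤ q) (ht : 0 ≤ t)
    (hA : ∀ β : G, 0 < β → β - γ ∈ H → ∃ β' : G, 0 < β' ∧ β' - γ ∈ H ∧ t + q • β' ≤ β)
    {β : G} (hβ : 0 < β) (hβγ : β - γ ∈ H)
    (harch : ∀ σ : G, 0 < σ → σ - γ ∈ H → ∃ n : ℕ, β ≤ n • σ) (N : ℕ) :
    ∃ h ∈ H, 0 < h ∧ N • h ≤ q • β ∧ ∃ m : ℕ, q • β ≤ m • h := by
  obtain ⟨β₁, h1, h2, h3⟩ := exists_pow_nsmul_le_of_forall_exists_coset ht hA N hβ hβγ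
  obtain ⟨β₂, h4, h5, h6⟩ := hA β₁ h1 h2
  have h7 : 2 • β₂ ≤ q • β₂ := nsmul_le_nsmul_left h4.le hq
  obtain ⟨m, hm⟩ := harch β₂ h4 h5
  have h8 : β₂ ≤ β₁ - β₂ := by grind
  refine ⟨β₁ - β₂, by simpa using sub_mem h2 h5, by grind, ?_, q * m, ?_⟩
  · have h9 : N • (β₁ - β₂) ≤ N • β₁ := nsmul_le_nsmul_right (by grind) N
    have h10 : N • β₁ ≤ (q ^ N) • β₁ :=
      nsmul_le_nsmul_left h1.le (Nat.lt_pow_self (by omega)).le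
    have h11 : β ≤ q • β := by simpa using nsmul_le_nsmul_left hβ.le (show 1 ≤ q by omega)
    exact h9.trans (h10.trans (h3.trans h11))
  · rw [mul_nsmul']
    exact nsmul_le_nsmul_right (hm.trans (nsmul_le_nsmul_right h8 m)) q

theorem forall_exists_coset_of_small (hq : 1 ≤ q)
    (h1 : ∀ β : G, 0 < β → β - γ ∈ H → ∀ n : ℕ, n • t < β)
    (h2 : ∀ β : G, 0 < β → β - γ ∈ H →
      (∀ σ : G, 0 < σ → σ - γ ∈ H → ∃ n : ℕ, β ≤ n • σ) →
      ∀ N : ℕ, ∃ h ∈ H, 0 < h ∧ N • h ≤ q • β ∧ ∃ m : ℕ, q • β ≤ m • h)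
    {β : G} (hβ : 0 < β) (hβγ : β - γ ∈ H) :
    ∃ β' : G, 0 < β' ∧ β' - γ ∈ H ∧ t + q • β' ≤ β := by
  have hβq : β ≤ q • β := by simpa using nsmul_le_nsmul_left hβ.le hq
  -- Half of `β` accommodates `q β'`, the other half absorbs `t`, since `2 t < β`.
  suffices ∃ β' : G, 0 < β' ∧ β' - γ ∈ H ∧ (q * 2) • β' ≤ β by
    obtain ⟨β', h3, h4, h5⟩ := this
    refine ⟨β', h3, h4, ?_⟩
    have h6 := h1 β hβ hβγ 2
    rw [mul_nsmul, two_nsmul] at h5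
    grind
  by_cases harch : ∀ σ : G, 0 < σ → σ - γ ∈ H → ∃ n : ℕ, β ≤ n • σ
  · obtain ⟨e, heH, he0, he, m, hm⟩ := h2 β hβ hβγ harch (q * (q * 2))
    have he' : (q * 2) • e ≤ β := by
      rw [mul_nsmul'] at he
      exact le_of_nsmul_le_nsmul_right (by omega) he
    -- subtract multiples of `e` from `β`
    classical
    have hex : ∃ n : ℕ, β ≤ n • e := ⟨m, hβq.trans hm⟩
    have hn := Nat.find_spec hex
    have hn0 : Nat.find hex ≠ 0 := by
      intro h0
      rw [h0, zero_nsmul] at hn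
      exact absurd hβ (not_lt.2 hn)
    obtain ⟨k, hk⟩ : ∃ k, Nat.find hex = k + 1 := ⟨Nat.find hex - 1, by omega⟩
    have hk' : k • e < β := not_le.1 (Nat.find_min hex (by omega))
    rw [hk, succ_nsmul] at hn
    refine ⟨β - k • e, sub_pos.2 hk', ?_, le_trans (nsmul_le_nsmul_right (by grind) _) he'⟩
    rw [sub_right_comm]
    exact sub_mem hβγ (nsmul_mem heH k)
  -- Some coset element is infinitesimal against `β` and serves as `β'`.
  · push Not at harch
    obtain ⟨σ, h3, h4, h5⟩ := harch
    exact ⟨σ, h3, h4, (h5 _).le⟩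

end CosetCriterion

/-! ### Arithmetic of values in the value group. -/

section Val

variable {F Γ : Type*} [Field F] [AddCommGroup Γ] [LinearOrder Γ] [IsOrderedAddMonoid Γ]
  (v : AddValuation F (WithTop Γ))

theorem val_mul {x y : F} (hx : x ≠ 0) (hy : y ≠ 0) : val v (x * y) = val v x + val v y := by
  ext
  have : ((val v (x * y) : Γ) : WithTop Γ) = ((val v x + val v y : Γ) : WithTop Γ) := by
    rw [WithTop.coe_add, coe_val v (mul_ne_zero hx hy), coe_val v hx, coe_val v hy, v.map_mul]
  exact_mod_cast this

theorem val_one : val v (1 : F) = 0 := by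
  have := val_mul v (one_ne_zero (α := F)) one_ne_zero
  rw [mul_one] at this
  exact left_eq_add.1 this

theorem val_pow {x : F} (hx : x ≠ 0) (n : ℕ) : val v (x ^ n) = n • val v x := by
  induction n with
  | zero => simp [val_one]
  | succ n ih => rw [pow_succ, val_mul v (pow_ne_zero n hx) hx, ih, succ_nsmul]

theorem val_inv {x : F} (hx : x ≠ 0) : val v x⁻¹ = -val v x := by
  have := val_mul v hx (inv_ne_zero hx)
  rw [mul_inv_cancel₀ hx, val_one] at this
  exact eq_neg_of_add_eq_zero_right this.symm

theorem val_div {x y : F} (hx : x ≠ 0) (hy : y ≠ 0) : val v (x / y) = val v x - val v y := by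
  rw [div_eq_mul_inv, val_mul v hx (inv_ne_zero hy), val_inv v hy, sub_eq_add_neg]

theorem val_le_val_iff {x y : F} (hx : x ≠ 0) (hy : y ≠ 0) : val v x ≤ val v y ↔ v x ≤ v y := by
  rw [← coe_val v hx, ← coe_val v hy, WithTop.coe_le_coe]
  rfl

theorem val_lt_val_iff {x y : F} (hx : x ≠ 0) (hy : y ≠ 0) : val v x < val v y ↔ v x < v y := by
  rw [← coe_val v hx, ← coe_val v hy, WithTop.coe_lt_coe]
  rfl

theorem val_eq_val_iff {x y : F} (hx : x ≠ 0) (hy : y ≠ 0) : val v x = val v y ↔ v x = v y := by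
  rw [le_antisymm_iff, val_le_val_iff v hx hy, val_le_val_iff v hy hx, ← le_antisymm_iff]

theorem val_pos_iff {x : F} (hx : x ≠ 0) : 0 < val v x ↔ 0 < v x := by
  rw [← val_one v, val_lt_val_iff v one_ne_zero hx, v.map_one]

theorem val_nonneg_iff {x : F} (hx : x ≠ 0) : 0 ≤ val v x ↔ 0 ≤ v x := by
  rw [← val_one v, val_le_val_iff v one_ne_zero hx, v.map_one]

theorem val_neg_iff {x : F} (hx : x ≠ 0) : val v x < 0 ↔ v x < 0 := by
  rw [← val_one v, val_lt_val_iff v hx one_ne_zero, v.map_one]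

theorem val_eq_zero_iff {x : F} (hx : x ≠ 0) : val v x = 0 ↔ v x = 0 := by
  rw [← val_one v, val_eq_val_iff v hx one_ne_zero, v.map_one]

theorem exists_val_eq (γ : valGroup v) : ∃ x : F, x ≠ 0 ∧ val v x = γ := by
  obtain ⟨x, hx⟩ := γ.2
  have h0 : x ≠ 0 := by
    rintro rfl
    rw [v.map_zero] at hx
    exact WithTop.top_ne_coe hx
  refine ⟨x, h0, ?_⟩
  ext
  have := coe_val v h0
  rw [hx] at this
  exact_mod_cast this

/-- A nonzero term of least value is the only one of that value, so the ultrametric inequality is an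
equality there. -/
theorem addVal_sum_le {ι : Type*} (s : Finset ι) (f : ι → F)
    (hf : ∀ i ∈ s, ∀ j ∈ s, i ≠ j → f i ≠ 0 → v (f i) ≠ v (f j)) {i : ι} (hi : i ∈ s) :
    v (∑ j ∈ s, f j) ≤ v (f i) := by
  classical
  obtain ⟨k, hk, hmin⟩ := s.exists_min_image (fun i => v (f i)) ⟨i, hi⟩
  refine le_trans ?_ (hmin i hi)
  by_cases hk0 : f k = 0
  · rw [hk0, v.map_zero]; exact le_top
  rw [← Finset.add_sum_erase s f hk]
  have hlt : v (f k) < v (∑ j ∈ s.erase k, f j) := by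
    refine v.map_lt_sum (fun h => hk0 ((v.top_iff).1 h)) fun j hj => ?_
    have hj' := Finset.mem_erase.1 hj
    exact lt_of_le_of_ne (hmin j hj'.2) (hf k hk j hj'.2 hj'.1.symm hk0)
  exact (v.map_add_eq_of_lt_left hlt).le

end Val

/-! ### Valuation independence of the powers of an element with value outside `vK`. -/

section Extension

variable {K L Γ : Type*} [Field K] [Field L] [Algebra K L]
  [AddCommGroup Γ] [LinearOrder Γ] [IsOrderedAddMonoid Γ]

/-- The value group `vK` as a subgroup of `vL`. -/
def baseGroup (K : Type*) {L Γ : Type*} [Field K] [Field L] [Algebra K L]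
    [AddCommGroup Γ] [LinearOrder Γ] [IsOrderedAddMonoid Γ]
    (v : AddValuation L (WithTop Γ)) : AddSubgroup (valGroup v) :=
  (valGroup (restrictVal K v)).addSubgroupOf (valGroup v)

variable (v : AddValuation L (WithTop Γ))

theorem mem_baseGroup_iff {γ : valGroup v} :
    γ ∈ baseGroup K v ↔ ∃ c : K, c ≠ 0 ∧ val v (algebraMap K L c) = γ := by
  constructor
  · intro h
    obtain ⟨c, hc0, hc⟩ := exists_val_eq (restrictVal K v) ⟨γ.1, h⟩
    refine ⟨c, hc0, ?_⟩
    have h := congrArg Subtype.val hc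
    exact Subtype.ext h
  · rintro ⟨c, hc0, rfl⟩
    exact ⟨c, (coe_val v ((map_ne_zero (algebraMap K L)).2 hc0)).symm⟩

theorem val_algebraMap_mem {c : K} (hc : c ≠ 0) : val v (algebraMap K L c) ∈ baseGroup K v :=
  (mem_baseGroup_iff v).2 ⟨c, hc, rfl⟩

variable {v} {q : ℕ}

theorem ne_zero_of_val_notMem {x : L} (hx : val v x ∉ baseGroup K v) : x ≠ 0 := by
  rintro rfl
  refine hx ?_
  have : val v (0 : L) = 0 := by ext; simp [val]
  rw [this]
  exact zero_mem _

theorem val_mul_pow {c : K} (hc : c ≠ 0) {x : L} (hx : x ≠ 0) (i : ℕ) :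
    val v (algebraMap K L c * x ^ i) = val v (algebraMap K L c) + i • val v x := by
  rw [val_mul v ((map_ne_zero _).2 hc) (pow_ne_zero i hx), val_pow v hx]

/-- The two values lie in the cosets of `i • v x` and `j • v x`, which differ because `v x` has
order `q` modulo `vK`. -/
theorem addVal_mul_pow_ne (hq : q.Prime) (he : (baseGroup K v).index = q) {x : L}
    (hx : val v x ∉ baseGroup K v) (c : ℕ → K) {i j : ℕ} (hi : i < q) (hj : j < q) (hij : i ≠ j)
    (h0 : algebraMap K L (c i) * x ^ i ≠ 0) :
    v (algebraMap K L (c i) * x ^ i) ≠ v (algebraMap K L (c j) * x ^ j) := by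
  have hx0 := ne_zero_of_val_notMem hx
  intro heq
  have h0' : algebraMap K L (c j) * x ^ j ≠ 0 := by
    intro h
    rw [h, v.map_zero, v.top_iff] at heq
    exact h0 heq
  have hci : c i ≠ 0 := by rintro h; simp [h] at h0
  have hcj : c j ≠ 0 := by rintro h; simp [h] at h0'
  rw [← val_eq_val_iff v h0 h0', val_mul_pow hci hx0, val_mul_pow hcj hx0] at heq
  have h1 := val_algebraMap_mem v hci
  have h2 := val_algebraMap_mem v hcj
  rcases lt_or_gt_of_ne hij with h | h
  · refine hx (mem_of_nsmul_mem_of_index_prime hq he (i := j - i) (by omega) (by omega) ?_)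
    have : (j - i) • val v x = val v (algebraMap K L (c i)) - val v (algebraMap K L (c j)) := by
      rw [sub_nsmul _ h.le]
      grind
    rw [this]
    exact sub_mem h1 h2
  · refine hx (mem_of_nsmul_mem_of_index_prime hq he (i := i - j) (by omega) (by omega) ?_)
    have : (i - j) • val v x = val v (algebraMap K L (c j)) - val v (algebraMap K L (c i)) := by
      rw [sub_nsmul _ h.le]
      grind
    rw [this]
    exact sub_mem h2 h1

/-- If `v x ∉ vK`, then `1, x, …, x ^ (q - 1)` are valuation independent. -/
theorem addVal_sum_mul_pow_le (hq : q.Prime) (he : (baseGroup K v).index = q) {x : L}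
    (hx : val v x ∉ baseGroup K v) (c : ℕ → K) {i : ℕ} (hi : i < q) :
    v (∑ j ∈ Finset.range q, algebraMap K L (c j) * x ^ j) ≤ v (algebraMap K L (c i) * x ^ i) :=
  addVal_sum_le v (Finset.range q) _ (fun _ hi _ hj hij h0 =>
    addVal_mul_pow_ne hq he hx c (Finset.mem_range.1 hi) (Finset.mem_range.1 hj) hij h0)
    (Finset.mem_range.2 hi)

theorem exists_eq_sum_mul_pow (hq : q.Prime) (he : (baseGroup K v).index = q)
    (hdeg : Module.finrank K L = q) {x : L} (hx : val v x ∉ baseGroup K v) (y : L) :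
    ∃ c : ℕ → K, y = ∑ j ∈ Finset.range q, algebraMap K L (c j) * x ^ j := by
  have hx0 := ne_zero_of_val_notMem hx
  have hli : LinearIndependent K (fun i : Fin q => x ^ (i : ℕ)) := by
    rw [Fintype.linearIndependent_iff]
    intro g hg i
    set c : ℕ → K := fun n => if h : n < q then g ⟨n, h⟩ else 0 with hc
    have hsum : ∑ j ∈ Finset.range q, algebraMap K L (c j) * x ^ j = 0 := by
      rw [Finset.sum_range, ← hg]
      refine Finset.sum_congr rfl fun j _ => ?_
      rw [Algebra.smul_def, hc]
      simp
    have h1 := addVal_sum_mul_pow_le hq he hx c i.2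
    rw [hsum, v.map_zero, top_le_iff, v.top_iff, mul_eq_zero, or_iff_left (pow_ne_zero _ hx0),
      map_eq_zero] at h1
    simpa [hc] using h1
  have : Nonempty (Fin q) := ⟨⟨0, hq.pos⟩⟩
  have hspan := hli.span_eq_top_of_card_eq_finrank (by rw [Fintype.card_fin, hdeg])
  have hy : y ∈ Submodule.span K (Set.range fun i : Fin q => x ^ (i : ℕ)) := hspan ▸ trivial
  obtain ⟨g, hg⟩ := (Submodule.mem_span_range_iff_exists_fun K).1 hy
  refine ⟨fun n => if h : n < q then g ⟨n, h⟩ else 0, ?_⟩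
  rw [Finset.sum_range, ← hg]
  refine Finset.sum_congr rfl fun j _ => ?_
  rw [Algebra.smul_def]
  simp

end Extension

/-! ### Galois invariance of the valuation and integrality of `O_L` over `O_K`. -/

section Galois

variable {K L Γ : Type*} [Field K] [Field L] [Algebra K L]
  [AddCommGroup Γ] [LinearOrder Γ] [IsOrderedAddMonoid Γ]
  {v : AddValuation L (WithTop Γ)} {q : ℕ}

/-- Write `x ^ q = ∑ a_i x ^ i` with `i < q`; by independence every term has value at least `q v x`.
Since `σ x` satisfies the same equation, `v (σ x) < v x` would make `(σ x) ^ q` of smaller value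
than every term of the sum it equals. -/
theorem addVal_le_algEquiv_of_notMem (hq : q.Prime) (he : (baseGroup K v).index = q)
    (hdeg : Module.finrank K L = q) (σ : L ≃ₐ[K] L) {x : L} (hx : val v x ∉ baseGroup K v) :
    v x ≤ v (σ x) := by
  have hx0 := ne_zero_of_val_notMem hx
  have hy0 : σ x ≠ 0 := by simpa using hx0
  obtain ⟨a, ha⟩ := exists_eq_sum_mul_pow hq he hdeg hx (x ^ q)
  have hσ : (σ x) ^ q = ∑ j ∈ Finset.range q, algebraMap K L (a j) * (σ x) ^ j := by
    rw [← map_pow, ha, map_sum]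
    refine Finset.sum_congr rfl fun j _ => ?_
    rw [map_mul, map_pow, σ.commutes]
  by_contra! hlt
  rw [← val_lt_val_iff v hy0 hx0] at hlt
  have hfin : v ((σ x) ^ q) ≠ ⊤ := fun h => pow_ne_zero q hy0 (v.top_iff.1 h)
  have := v.map_lt_sum (s := Finset.range q)
    (f := fun j => algebraMap K L (a j) * (σ x) ^ j) hfin (fun i hi => ?_)
  · rw [← hσ] at this
    exact lt_irrefl _ this
  · rw [Finset.mem_range] at hi
    by_cases hai : a i = 0
    · rw [hai, map_zero, zero_mul, v.map_zero]
      exact lt_top_iff_ne_top.2 hfin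
    have hai' : algebraMap K L (a i) ≠ 0 := (map_ne_zero _).2 hai
    have h1 := addVal_sum_mul_pow_le hq he hx a hi
    rw [← ha, ← val_le_val_iff v (pow_ne_zero q hx0) (mul_ne_zero hai' (pow_ne_zero i hx0)),
      val_mul_pow hai hx0, val_pow v hx0] at h1
    rw [← val_lt_val_iff v (pow_ne_zero q hy0) (mul_ne_zero hai' (pow_ne_zero i hy0)),
      val_mul_pow hai hy0, val_pow v hy0]
    have h2 : (q - i) • val v (σ x) < (q - i) • val v x := nsmul_lt_nsmul_right (by omega) hlt
    rw [sub_nsmul _ hi.le, sub_nsmul _ hi.le] at h2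
    grind

theorem addVal_le_algEquiv (hq : q.Prime) (he : (baseGroup K v).index = q)
    (hdeg : Module.finrank K L = q) (σ : L ≃ₐ[K] L) (y : L) : v y ≤ v (σ y) := by
  obtain ⟨g, -, hg⟩ := exists_pos_notMem hq he
  obtain ⟨x, hx0, rfl⟩ := exists_val_eq v g
  obtain ⟨c, hc⟩ := exists_eq_sum_mul_pow hq he hdeg hg y
  have hσ : σ y = ∑ j ∈ Finset.range q, algebraMap K L (c j) * (σ x) ^ j := by
    rw [hc, map_sum]
    refine Finset.sum_congr rfl fun j _ => ?_
    rw [map_mul, map_pow, σ.commutes]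
  rw [hσ]
  refine v.map_le_sum fun i hi => ?_
  have h1 := addVal_sum_mul_pow_le hq he hg c (Finset.mem_range.1 hi)
  rw [← hc] at h1
  refine h1.trans ?_
  rw [v.map_mul, v.map_mul, v.map_pow, v.map_pow]
  gcongr
  exact addVal_le_algEquiv_of_notMem hq he hdeg σ hg

/-- The valuation is invariant under the Galois group (the extension is unibranched). -/
theorem addVal_algEquiv (hq : q.Prime) (he : (baseGroup K v).index = q)
    (hdeg : Module.finrank K L = q) (σ : L ≃ₐ[K] L) (y : L) : v (σ y) = v y :=
  le_antisymm (by simpa using addVal_le_algEquiv hq he hdeg σ.symm (σ y))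
    (addVal_le_algEquiv hq he hdeg σ y)

instance : IsScalarTower (valRing (restrictVal K v)) (valRing v) L :=
  IsScalarTower.of_algebraMap_eq fun _ => rfl

/-- The roots of the minimal polynomial over `K` are conjugates of `y`, so they lie in `O_L`; its
coefficients therefore lie in `O_L ∩ K = O_K`. -/
theorem isIntegral_of_addVal_nonneg [IsGalois K L] (hq : q.Prime)
    (he : (baseGroup K v).index = q) (hdeg : Module.finrank K L = q) {y : L} (hy : 0 ≤ v y) :
    IsIntegral (valRing (restrictVal K v)) y := by
  have : FiniteDimensional K L := FiniteDimensional.of_finrank_pos (hdeg ▸ hq.pos)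
  have hint : IsIntegral K y := Algebra.IsIntegral.isIntegral y
  have hsplit := Normal.splits (inferInstance : Normal K L) y
  have hmem : (minpoly K y).map (algebraMap K L) ∈
      Polynomial.lifts (algebraMap (valRing v) L) := by
    rw [Polynomial.Splits.eq_prod_roots_of_monic hsplit ((minpoly.monic hint).map _)]
    refine multiset_prod_mem _ fun p hp => ?_
    obtain ⟨a, ha, rfl⟩ := Multiset.mem_map.1 hp
    have haroot : a ∈ (minpoly K y).aroots L := ha
    rw [Polynomial.mem_aroots] at haroot
    obtain ⟨σ, hσ⟩ := minpoly.exists_algEquiv_of_root' (Algebra.IsAlgebraic.isAlgebraic y)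
      haroot.2
    have ha0 : 0 ≤ v a := by rw [← hσ, addVal_algEquiv hq he hdeg]; exact hy
    exact ⟨Polynomial.X - Polynomial.C ⟨a, ha0⟩, by simp⟩
  have hmem' : minpoly K y ∈ Polynomial.lifts (algebraMap (valRing (restrictVal K v)) K) := by
    rw [Polynomial.lifts_iff_coeff_lifts] at hmem ⊢
    intro n
    obtain ⟨z, hz⟩ := hmem n
    rw [Polynomial.coeff_map] at hz
    have h0 : 0 ≤ v (algebraMap K L ((minpoly K y).coeff n)) := by
      rw [← hz]; exact z.2
    exact ⟨⟨_, h0⟩, rfl⟩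
  obtain ⟨p, hp, -, hmon⟩ := Polynomial.lifts_and_natDegree_eq_and_monic hmem' (minpoly.monic hint)
  refine ⟨p, hmon, ?_⟩
  have : Polynomial.aeval y (p.map (algebraMap (valRing (restrictVal K v)) K)) = 0 := by
    rw [hp, minpoly.aeval]
  rwa [Polynomial.aeval_map_algebraMap] at this

end Galois

/-! ### When `O_L` is the union of the rings `O_K[c θ]`. -/

section Generation

variable {K L Γ : Type*} [Field K] [Field L] [Algebra K L]
  [AddCommGroup Γ] [LinearOrder Γ] [IsOrderedAddMonoid Γ]
  {v : AddValuation L (WithTop Γ)} {q : ℕ}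

theorem addVal_nonneg_of_mem_adjoin {x y : L} (hx : 0 ≤ v x)
    (hy : y ∈ Algebra.adjoin (valRing (restrictVal K v)) {x}) : 0 ≤ v y := by
  induction hy using Algebra.adjoin_induction with
  | mem z hz => rwa [Set.mem_singleton_iff.1 hz]
  | algebraMap r => exact r.2
  | add a b _ _ ha hb => exact (valRing v).add_mem a b ha hb
  | mul a b _ _ ha hb => exact (valRing v).mul_mem a b ha hb

theorem generatesValRing_iff {θ : L} : GeneratesValRing K v θ ↔
    ∀ y : L, 0 ≤ v y → ∃ c : K, c ≠ 0 ∧ 0 < v (algebraMap K L c * θ) ∧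
      y ∈ Algebra.adjoin (valRing (restrictVal K v)) {algebraMap K L c * θ} := by
  constructor
  · intro h y hy
    have hy' : y ∈ (valRing v : Set L) := hy
    rw [h] at hy'
    simp only [Set.mem_iUnion] at hy'
    obtain ⟨c, hc, hy'⟩ := hy'
    exact ⟨c, hc.1, hc.2, hy'⟩
  · intro h
    ext y
    simp only [Set.mem_iUnion]
    constructor
    · intro hy
      obtain ⟨c, hc, hc', hy⟩ := h y hy
      exact ⟨c, ⟨hc, hc'⟩, hy⟩
    · rintro ⟨c, hc, hy⟩
      exact addVal_nonneg_of_mem_adjoin hc.2.le hy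

theorem exists_mul_val_eq {θ : L} (hθ : θ ≠ 0) {β : valGroup v}
    (hβ : β - val v θ ∈ baseGroup K v) :
    ∃ c : K, c ≠ 0 ∧ val v (algebraMap K L c * θ) = β := by
  obtain ⟨c, hc, h⟩ := (mem_baseGroup_iff v).1 hβ
  exact ⟨c, hc, by rw [val_mul v ((map_ne_zero _).2 hc) hθ, h, sub_add_cancel]⟩

/-- As `q γ ∈ vK`, the elements `γ` and `γ - q γ` share a coset and have opposite signs. -/
theorem exists_pos_in_coset (hq : q.Prime) (he : (baseGroup K v).index = q) {γ : valGroup v}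
    (hγ : γ ≠ 0) : ∃ β : valGroup v, 0 < β ∧ β - γ ∈ baseGroup K v := by
  rcases lt_or_gt_of_ne hγ with h | h
  · refine ⟨γ - q • γ, ?_, ?_⟩
    · have h1 := nsmul_lt_nsmul_left (neg_pos.2 h) hq.one_lt
      rw [one_nsmul, smul_neg] at h1
      exact sub_pos.2 (neg_lt_neg_iff.1 h1)
    · rw [sub_right_comm, sub_self, zero_sub]
      exact neg_mem (nsmul_mem_of_index_eq he γ)
  · exact ⟨γ, h, by simp⟩

theorem mul_pow_mem_adjoin {a c : K} (hc : c ≠ 0) (θ : L) (i : ℕ)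
    (h : a ≠ 0 → i • val v (algebraMap K L c) ≤ val v (algebraMap K L a)) :
    algebraMap K L a * θ ^ i ∈
      Algebra.adjoin (valRing (restrictVal K v)) {algebraMap K L c * θ} := by
  have hc' : algebraMap K L c ≠ 0 := (map_ne_zero _).2 hc
  have heq : algebraMap K L a * θ ^ i =
      algebraMap K L (a / c ^ i) * (algebraMap K L c * θ) ^ i := by
    rw [map_div₀, map_pow, mul_pow, ← mul_assoc, div_mul_cancel₀ _ (pow_ne_zero i hc')]
  rw [heq]
  refine mul_mem ?_ (pow_mem (Algebra.subset_adjoin (Set.mem_singleton _)) i)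
  suffices h : 0 ≤ v (algebraMap K L (a / c ^ i)) from
    Subalgebra.algebraMap_mem _ (⟨a / c ^ i, h⟩ : valRing (restrictVal K v))
  by_cases ha : a = 0
  · rw [ha, zero_div, map_zero, v.map_zero]
    exact le_top
  have ha' : algebraMap K L a ≠ 0 := (map_ne_zero _).2 ha
  rw [map_div₀, map_pow, ← val_nonneg_iff v (div_ne_zero ha' (pow_ne_zero i hc')),
    val_div v ha' (pow_ne_zero i hc'), val_pow v hc', sub_nonneg]
  exact h ha

/-- If the coset of `v θ` modulo `vK` has sufficiently small positive elements, then `O_L` is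
the union of the rings `O_K[c θ]` with `v (c θ) > 0`. -/
theorem generatesValRing_of_coset_small (hq : q.Prime) (he : (baseGroup K v).index = q)
    (hdeg : Module.finrank K L = q) {θ : L} (hθ : val v θ ∉ baseGroup K v)
    (hsm : ∀ i : ℕ, 0 < i → i < q → ∀ α : valGroup v, 0 < α → α - i • val v θ ∈ baseGroup K v →
      ∃ β : valGroup v, 0 < β ∧ β - val v θ ∈ baseGroup K v ∧ i • β ≤ α) :
    GeneratesValRing K v θ := by
  have hθ0 := ne_zero_of_val_notMem hθ
  have hγ0 : val v θ ≠ 0 := fun h => hθ (h ▸ zero_mem _)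
  rw [generatesValRing_iff]
  intro y hy
  obtain ⟨a, ha⟩ := exists_eq_sum_mul_pow hq he hdeg hθ y
  have hterm : ∀ i < q, 0 ≤ v (algebraMap K L (a i) * θ ^ i) := fun i hi =>
    hy.trans (by rw [ha]; exact addVal_sum_mul_pow_le hq he hθ a hi)
  -- Each relevant index bounds the admissible value of `c θ`; an index without a constraint gets an
  -- arbitrary positive element of the coset.
  have hb : ∀ i : ℕ, ∃ β : valGroup v, 0 < β ∧ β - val v θ ∈ baseGroup K v ∧
      (0 < i → i < q → a i ≠ 0 → i • β ≤ val v (algebraMap K L (a i) * θ ^ i)) := by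
    intro i
    by_cases hi : 0 < i ∧ i < q ∧ a i ≠ 0
    · obtain ⟨hi0, hiq, hai⟩ := hi
      have h0 : algebraMap K L (a i) * θ ^ i ≠ 0 :=
        mul_ne_zero ((map_ne_zero _).2 hai) (pow_ne_zero _ hθ0)
      have h1 : val v (algebraMap K L (a i) * θ ^ i) - i • val v θ ∈ baseGroup K v := by
        rw [val_mul_pow hai hθ0, add_sub_cancel_right]
        exact val_algebraMap_mem v hai
      have h2 : 0 < val v (algebraMap K L (a i) * θ ^ i) := by
        -- Value zero is excluded because `i • v θ ∉ vK` for `0 < i < q`.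
        refine lt_of_le_of_ne ((val_nonneg_iff v h0).2 (hterm i hiq)) fun h3 => ?_
        rw [← h3, zero_sub, neg_mem_iff] at h1
        exact hθ (mem_of_nsmul_mem_of_index_prime hq he hi0 hiq h1)
      obtain ⟨β, h3, h4, h5⟩ := hsm i hi0 hiq _ h2 h1
      exact ⟨β, h3, h4, fun _ _ _ => h5⟩
    · obtain ⟨β, h1, h2⟩ := exists_pos_in_coset hq he hγ0
      exact ⟨β, h1, h2, fun h3 h4 h5 => (hi ⟨h3, h4, h5⟩).elim⟩
  choose β hβ0 hβH hβ using hb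
  -- The least of the `β i` meets all the bounds simultaneously.
  obtain ⟨k, -, hk⟩ := (Finset.range q).exists_min_image β ⟨0, Finset.mem_range.2 hq.pos⟩
  obtain ⟨c, hc, hcβ⟩ := exists_mul_val_eq hθ0 (hβH k)
  have hc' : algebraMap K L c ≠ 0 := (map_ne_zero _).2 hc
  have hcθ : algebraMap K L c * θ ≠ 0 := mul_ne_zero hc' hθ0
  refine ⟨c, hc, (val_pos_iff v hcθ).1 (hcβ ▸ hβ0 k), ?_⟩
  rw [ha]
  refine sum_mem fun i hi => ?_
  have hiq := Finset.mem_range.1 hi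
  rcases Nat.eq_zero_or_pos i with rfl | hi0
  · refine mul_pow_mem_adjoin hc θ 0 ?_
    intro h0
    rw [zero_nsmul]
    have h1 := hterm 0 hiq
    rw [pow_zero, mul_one] at h1
    exact (val_nonneg_iff v ((map_ne_zero _).2 h0)).2 h1
  · refine mul_pow_mem_adjoin hc θ i fun hai => ?_
    have h1 := hβ i hi0 hiq hai
    have h2 : i • β k ≤ i • β i := nsmul_le_nsmul_right (hk i hi) i
    rw [← hcβ, val_mul v hc' hθ0, nsmul_add] at h2
    rw [val_mul_pow hai hθ0] at h1
    exact le_of_add_le_add_right (h2.trans h1)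

/-- The value of `θ` generates `vL / vK`, so `j` can be chosen to reach the good coset of
`exists_coset_small`. Only the coset matters, whence the freedom to scale by `d`. -/
theorem exists_pow_generatesValRing (hq : q.Prime) (he : (baseGroup K v).index = q)
    (hdeg : Module.finrank K L = q) {θ : L} (hθ : val v θ ∉ baseGroup K v) :
    ∃ j : ℕ, 1 ≤ j ∧ j < q ∧ ∀ d : K, d ≠ 0 →
      GeneratesValRing K v (algebraMap K L d * θ ^ j) := by
  have hθ0 := ne_zero_of_val_notMem hθ
  obtain ⟨π, hπ, hsm⟩ := exists_coset_small hq he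
  obtain ⟨j, hj, hjπ⟩ := exists_nsmul_sub_mem_of_index_prime hq he hθ π
  have hj0 : j ≠ 0 := by
    rintro rfl
    rw [zero_nsmul, zero_sub, neg_mem_iff] at hjπ
    exact hπ hjπ
  refine ⟨j, by omega, hj, fun d hd => ?_⟩
  have hsub : val v (algebraMap K L d * θ ^ j) - π ∈ baseGroup K v := by
    rw [val_mul_pow hd hθ0, add_sub_assoc]
    exact add_mem (val_algebraMap_mem v hd) hjπ
  refine generatesValRing_of_coset_small hq he hdeg (fun h => ?_) fun i hi0 hi α hα hαi => ?_
  · exact hπ (by simpa using sub_mem h hsub)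
  · obtain ⟨β, h1, h2, h3⟩ := hsm i hi0 hi α hα (by
      have := add_mem hαi (nsmul_mem hsub i)
      rwa [nsmul_sub, sub_add_sub_cancel] at this)
    exact ⟨β, h1, by simpa using sub_mem h2 hsub, h3⟩

end Generation

/-! ### Values of integers and the residue field. -/

section ResidueChar

variable {L Γ : Type*} [Field L] [AddCommGroup Γ] [LinearOrder Γ] [IsOrderedAddMonoid Γ]
  {v : AddValuation L (WithTop Γ)} {q : ℕ}

theorem addVal_natCast_nonneg (v : AddValuation L (WithTop Γ)) (n : ℕ) : 0 ≤ v (n : L) :=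
  natCast_mem (valRing v) n

theorem addVal_intCast_nonneg (v : AddValuation L (WithTop Γ)) (n : ℤ) : 0 ≤ v (n : L) :=
  intCast_mem (valRing v) n

theorem addVal_natCast_eq_zero (hv : 0 < v (q : L)) {n : ℕ} (hn : n.Coprime q) :
    v (n : L) = 0 := by
  by_contra hne
  have hpos : 0 < v (n : L) := lt_of_le_of_ne (addVal_natCast_nonneg v n) (Ne.symm hne)
  have hb := Nat.gcd_eq_gcd_ab n q
  rw [hn] at hb
  have h1 : (1 : L) = (n : L) * (Nat.gcdA n q : L) + (q : L) * (Nat.gcdB n q : L) := by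
    exact_mod_cast congrArg (Int.cast : ℤ → L) hb
  have h2 : 0 < v (1 : L) := by
    rw [h1]
    refine lt_of_lt_of_le (lt_min ?_ ?_) (v.map_add _ _)
    · rw [v.map_mul]
      exact add_pos_of_pos_of_nonneg hpos (addVal_intCast_nonneg v _)
    · rw [v.map_mul]
      exact add_pos_of_pos_of_nonneg hv (addVal_intCast_nonneg v _)
  rw [v.map_one] at h2
  exact lt_irrefl _ h2

theorem residue_eq_zero_iff_addVal_pos (x : valRing v) :
    IsLocalRing.residue (valRing v) x = 0 ↔ 0 < v (x : L) := by
  rw [IsLocalRing.residue_eq_zero_iff, IsLocalRing.mem_maximalIdeal, mem_nonunits_iff]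
  constructor
  · intro h
    refine lt_of_le_of_ne x.2 fun h0 => h ?_
    have hx0 : (x : L) ≠ 0 := by
      rintro hx
      rw [hx, v.map_zero] at h0
      exact WithTop.zero_ne_top h0
    have hinv : 0 ≤ v (x : L)⁻¹ := by
      rw [← val_nonneg_iff v (inv_ne_zero hx0), val_inv v hx0, (val_eq_zero_iff v hx0).2 h0.symm,
        neg_zero]
    exact IsUnit.of_mul_eq_one (⟨_, hinv⟩ : valRing v) (Subtype.ext (mul_inv_cancel₀ hx0))
  · rintro h hu
    obtain ⟨y, hy⟩ := hu.exists_right_inv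
    have h1 : v (x : L) + v (y : L) = 0 := by
      rw [← v.map_mul, ← v.map_one]
      exact congrArg (fun z : valRing v => v (z : L)) hy
    exact absurd h1 (add_pos_of_pos_of_nonneg h y.2).ne'

end ResidueChar

/-! ### Kummer generators with value outside `vK`. -/

section

variable {K L Γ : Type*} [Field K] [Field L] [Algebra K L]
  [AddCommGroup Γ] [LinearOrder Γ] [IsOrderedAddMonoid Γ]
  {v : AddValuation L (WithTop Γ)} {q : ℕ}

theorem charP_residueField_iff (hq : q.Prime) :
    CharP (IsLocalRing.ResidueField (valRing (restrictVal K v))) q ↔ 0 < v (q : L) := by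
  rw [CharP.charP_iff_prime_eq_zero hq,
    ← map_natCast (IsLocalRing.residue (valRing (restrictVal K v))) q,
    residue_eq_zero_iff_addVal_pos, restrictVal_apply]
  simp

theorem charZero_of_addVal_pos (hq : q.Prime) (hq0 : (q : K) ≠ 0) (hv : 0 < v (q : L)) :
    CharZero K := by
  rw [CharZero.charZero_iff_forall_prime_ne_zero]
  intro p hp hp0
  have hne : p ≠ q := by rintro rfl; exact hq0 hp0
  have h1 := addVal_natCast_eq_zero hv ((Nat.coprime_primes hp hq).2 hne)
  rw [← map_natCast (algebraMap K L), hp0, map_zero, v.map_zero] at h1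
  exact WithTop.top_ne_zero h1

theorem isKummerGenerator_of_val_notMem (hq : q.Prime) (he : (baseGroup K v).index = q)
    (hdeg : Module.finrank K L = q) {η : L} (hη : val v η ∉ baseGroup K v) {a : K}
    (ha : algebraMap K L a = η ^ q) : IsKummerGenerator K q η := by
  refine ⟨eq_top_iff.2 fun y _ => ?_, a, ha⟩
  obtain ⟨c, rfl⟩ := exists_eq_sum_mul_pow hq he hdeg hη y
  exact sum_mem fun i _ => mul_mem (IntermediateField.algebraMap_mem _ _)
    (pow_mem (IntermediateField.mem_adjoin_simple_self K η) i)

theorem val_pow_notMem (hq : q.Prime) (he : (baseGroup K v).index = q) {x : L}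
    (hx : val v x ∉ baseGroup K v) {j : ℕ} (hj0 : 0 < j) (hj : j < q) :
    val v (x ^ j) ∉ baseGroup K v := by
  rw [val_pow v (ne_zero_of_val_notMem hx)]
  exact fun h => hx (mem_of_nsmul_mem_of_index_prime hq he hj0 hj h)

theorem val_algebraMap_mul_notMem {x : L} (hx : val v x ∉ baseGroup K v) {d : K} (hd : d ≠ 0) :
    val v (algebraMap K L d * x) ∉ baseGroup K v := by
  rw [val_mul v ((map_ne_zero _).2 hd) (ne_zero_of_val_notMem hx)]
  intro h
  exact hx (by simpa using sub_mem h (val_algebraMap_mem v hd))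

/-- A suitable power of `η` generates `O_L`; scaling by an element of `K` makes its value negative
and keeps the coset. -/
theorem exists_kummerCaseI_of_val_notMem (hq : q.Prime) (he : (baseGroup K v).index = q)
    (hdeg : Module.finrank K L = q) {η : L} (hη : val v η ∉ baseGroup K v) {a : K}
    (ha : algebraMap K L a = η ^ q) : ∃ η' : L, KummerCaseI K v q η' := by
  obtain ⟨j, hj1, hjq, hgen⟩ := exists_pow_generatesValRing hq he hdeg hη
  have hj := val_pow_notMem hq he hη hj1 hjq
  have hj0 : η ^ j ≠ 0 := ne_zero_of_val_notMem hj
  obtain ⟨β, hβ0, hβ⟩ := exists_pos_in_coset hq he (γ := -val v (η ^ j))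
    (fun h => hj (by rw [neg_eq_zero.1 h]; exact zero_mem _))
  obtain ⟨d, hd, hdβ⟩ := exists_mul_val_eq hj0 (β := -β)
    (by simpa [add_comm, sub_eq_add_neg] using neg_mem hβ)
  have hd0 : algebraMap K L d * η ^ j ≠ 0 := mul_ne_zero ((map_ne_zero _).2 hd) hj0
  refine ⟨algebraMap K L d * η ^ j, ?_, ?_, hgen d hd⟩
  · refine isKummerGenerator_of_val_notMem hq he hdeg (val_algebraMap_mul_notMem hj hd)
      (a := d ^ q * a ^ j) ?_
    rw [map_mul, map_pow, map_pow, ha, mul_pow, ← pow_mul, ← pow_mul, mul_comm q j]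
  · rw [← val_neg_iff v hd0, hdβ]
    exact neg_lt_zero.2 hβ0

end

/-! ### Lagrange resolvents. -/

section Resolvent

variable {K L : Type*} [Field K] [Field L] [Algebra K L] {q : ℕ}

/-- The Lagrange resolvent of `x` with respect to `τ` and a root of unity `ω`. -/
def lagrangeResolvent (q : ℕ) (τ : L ≃ₐ[K] L) (ω : K) (x : L) : L :=
  ∑ k ∈ Finset.range q, algebraMap K L (ω ^ k) * (τ ^ k) x

/-- Applying `ω τ` shifts the summation index by one, cyclically. -/
theorem mul_apply_lagrangeResolvent {τ : L ≃ₐ[K] L} (hτ : τ ^ q = 1) {ω : K} (hω : ω ^ q = 1)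
    (x : L) : algebraMap K L ω * τ (lagrangeResolvent q τ ω x) = lagrangeResolvent q τ ω x := by
  have h := Finset.sum_range_succ' (fun k => algebraMap K L (ω ^ k) * (τ ^ k) x) q
  rw [Finset.sum_range_succ, show algebraMap K L (ω ^ q) * (τ ^ q) x =
    algebraMap K L (ω ^ 0) * (τ ^ 0) x by rw [hτ, hω, pow_zero, pow_zero]] at h
  have h' := add_right_cancel h
  rw [lagrangeResolvent, map_sum, Finset.mul_sum]
  refine Eq.trans (Finset.sum_congr rfl fun k _ => ?_) h'.symm
  rw [map_mul, τ.commutes, ← mul_assoc, ← map_mul, ← pow_succ', pow_succ' τ k]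
  rfl

/-- After exchanging the sums, the coefficient of `(τ ^ k) x` is a sum of powers of `ζ ^ k`, which
vanishes unless `k = 0`. -/
theorem sum_lagrangeResolvent (hq : 0 < q) {τ : L ≃ₐ[K] L} {ζ : K} (hζ : IsPrimitiveRoot ζ q)
    (x : L) : ∑ i ∈ Finset.range q, lagrangeResolvent q τ (ζ ^ i) x = (q : L) * x := by
  unfold lagrangeResolvent
  rw [Finset.sum_comm, Finset.sum_eq_single_of_mem 0 (Finset.mem_range.2 hq)]
  · simp
  · intro k hk hk0
    rw [← Finset.sum_mul, ← map_sum]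
    have h1 : ζ ^ k ≠ 1 := hζ.pow_ne_one_of_pos_of_lt hk0 (Finset.mem_range.1 hk)
    have h2 : ∑ i ∈ Finset.range q, (ζ ^ i) ^ k = 0 := by
      have h3 := mul_geom_sum (ζ ^ k) q
      rw [← pow_mul, mul_comm k q, pow_mul, hζ.pow_eq_one, one_pow, sub_self, mul_eq_zero,
        or_iff_right (sub_ne_zero.2 h1)] at h3
      rw [← h3]
      exact Finset.sum_congr rfl fun i _ => by rw [← pow_mul, ← pow_mul, mul_comm]
    rw [h2, map_zero, zero_mul]

end Resolvent

/-! ### Existence of generators as in case (i) or case (ii). -/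

section

variable {K L Γ : Type*} [Field K] [Field L] [Algebra K L]
  [AddCommGroup Γ] [LinearOrder Γ] [IsOrderedAddMonoid Γ]
  {v : AddValuation L (WithTop Γ)} {q : ℕ}

theorem IsKummerExtension.finiteDimensional (hK : IsKummerExtension K L q) (hq : q.Prime) :
    FiniteDimensional K L :=
  FiniteDimensional.of_finrank_pos (hK.finrank_eq ▸ hq.pos)

theorem IsKummerExtension.card_gal (hK : IsKummerExtension K L q) (hq : q.Prime) :
    Nat.card (L ≃ₐ[K] L) = q := by
  have := hK.finiteDimensional hq
  have := hK.isGalois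
  rw [IsGalois.card_aut_eq_finrank, hK.finrank_eq]

theorem IsKummerExtension.natCast_ne_zero (hK : IsKummerExtension K L q) (hq : q.Prime) :
    (q : K) ≠ 0 := by
  obtain ⟨ζ, hζ⟩ := hK.exists_root
  have : NeZero q := ⟨hq.ne_zero⟩
  exact hζ.neZero'.out

theorem addVal_eq_zero_of_pow_eq_one (hq : q ≠ 0) {u : L} (hu : u ^ q = 1) : v u = 0 := by
  have h0 : u ≠ 0 := by
    rintro rfl
    rw [zero_pow hq] at hu
    exact zero_ne_one hu
  rw [← val_eq_zero_iff v h0]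
  have h1 : q • val v u = 0 := by rw [← val_pow v h0, hu, val_one]
  exact (nsmul_eq_zero_iff.1 h1).resolve_right hq

/-- Take `x` with `v x ∉ vK`. Galois invariance gives every resolvent of `x` value at least `v x`,
while their sum `q x` has value exactly `v x`. So some resolvent attains `v x`, and its `q`-th power
is fixed by the Galois group. -/
theorem exists_kummerCaseI_of_addVal_eq_zero (hq : q.Prime) (he : (baseGroup K v).index = q)
    (hK : IsKummerExtension K L q) (hv : v (q : L) = 0) : ∃ η : L, KummerCaseI K v q η := by
  have := Fact.mk hq
  have := hK.finiteDimensional hq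
  have := hK.isGalois
  have hcard := hK.card_gal hq
  obtain ⟨ζ, hζ⟩ := hK.exists_root
  have := isCyclic_of_prime_card hcard
  obtain ⟨τ, hτ⟩ := IsCyclic.exists_generator (α := L ≃ₐ[K] L)
  have hτq : τ ^ q = 1 := hcard ▸ pow_card_eq_one'
  obtain ⟨g, -, hg⟩ := exists_pos_notMem hq he
  obtain ⟨x, hx0, rfl⟩ := exists_val_eq v g
  have hfin : v x ≠ ⊤ := fun h => hx0 (v.top_iff.1 h)
  have hroot : ∀ i : ℕ, (ζ ^ i) ^ q = 1 := fun i => by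
    rw [← pow_mul, mul_comm, pow_mul, hζ.pow_eq_one, one_pow]
  obtain ⟨i, -, hi⟩ : ∃ i ∈ Finset.range q, v (lagrangeResolvent q τ (ζ ^ i) x) ≤ v x := by
    by_contra! hcon
    have h1 := v.map_lt_sum hfin hcon
    rw [sum_lagrangeResolvent hq.pos hζ, v.map_mul, hv, zero_add] at h1
    exact lt_irrefl _ h1
  set ω := ζ ^ i with hω
  have hωq : ω ^ q = 1 := hroot i
  set y := lagrangeResolvent q τ ω x with hy
  have hyx : v y = v x := by
    refine le_antisymm hi (v.map_le_sum fun k _ => ?_)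
    rw [v.map_mul, addVal_algEquiv hq he hK.finrank_eq, map_pow, v.map_pow,
      addVal_eq_zero_of_pow_eq_one hq.ne_zero (u := algebraMap K L ω)
        (by rw [← map_pow, hωq, map_one])]
    simp
  have hy0 : y ≠ 0 := by
    rintro h
    rw [h, v.map_zero] at hyx
    exact hfin hyx.symm
  have hyH : val v y ∉ baseGroup K v := by
    rwa [(val_eq_val_iff v hy0 hx0).2 hyx]
  have hfix : ∀ σ : L ≃ₐ[K] L, σ (y ^ q) = y ^ q := by
    have h1 : τ ∈ MulAction.stabilizer (L ≃ₐ[K] L) (y ^ q) := by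
      rw [MulAction.mem_stabilizer_iff]
      change τ (y ^ q) = y ^ q
      have h2 := congrArg (· ^ q) (mul_apply_lagrangeResolvent hτq hωq x)
      simp only [mul_pow, ← map_pow, hωq, map_one, one_mul] at h2
      exact h2
    intro σ
    exact MulAction.mem_stabilizer_iff.1 ((Subgroup.zpowers_le.2 h1) (hτ σ))
  obtain ⟨a, ha⟩ := (IsGalois.mem_range_algebraMap_iff_fixed (y ^ q)).2 hfix
  exact exists_kummerCaseI_of_val_notMem hq he hK.finrank_eq hyH ha

theorem exists_isKummerGenerator (hq : q.Prime) (hK : IsKummerExtension K L q) :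
    ∃ η : L, IsKummerGenerator K q η := by
  have := Fact.mk hq
  have := hK.finiteDimensional hq
  have := hK.isGalois
  have := isCyclic_of_prime_card (hK.card_gal hq)
  obtain ⟨ζ, hζ⟩ := hK.exists_root
  obtain ⟨η, ⟨a, ha⟩, hη⟩ := exists_root_adjoin_eq_top_of_isCyclic K L
    ⟨ζ, by rwa [hK.finrank_eq, mem_primitiveRoots hq.pos]⟩
  rw [hK.finrank_eq] at ha
  exact ⟨η, hη, a, ha⟩

theorem IsKummerGenerator.notMem_range {η : L} (hη : IsKummerGenerator K q η) (hq : q.Prime)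
    (hK : IsKummerExtension K L q) (c : K) : algebraMap K L c ≠ η := by
  rintro rfl
  have h1 := hη.1
  rw [IntermediateField.adjoin_simple_eq_bot_iff.2 (IntermediateField.algebraMap_mem _ c)] at h1
  have h2 := hK.finrank_eq
  rw [← IntermediateField.finrank_top', ← h1, IntermediateField.finrank_bot] at h2
  exact hq.one_lt.ne h2

theorem adjoin_algebraMap_mul_eq_top {θ : L} (h : IntermediateField.adjoin K {θ} = ⊤) {d : K}
    (hd : d ≠ 0) : IntermediateField.adjoin K {algebraMap K L d * θ} = ⊤ := by
  rw [eq_top_iff, ← h, IntermediateField.adjoin_simple_le_iff]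
  have h1 := mul_mem (IntermediateField.algebraMap_mem
    (IntermediateField.adjoin K {algebraMap K L d * θ}) d⁻¹)
    (IntermediateField.mem_adjoin_simple_self K (algebraMap K L d * θ))
  rwa [map_inv₀, inv_mul_cancel_left₀ ((map_ne_zero _).2 hd)] at h1

theorem IsKummerGenerator.algebraMap_mul {η : L} (hη : IsKummerGenerator K q η) {d : K}
    (hd : d ≠ 0) : IsKummerGenerator K q (algebraMap K L d * η) := by
  obtain ⟨htop, a, ha⟩ := hη
  exact ⟨adjoin_algebraMap_mul_eq_top htop hd, d ^ q * a, by rw [map_mul, map_pow, ha, mul_pow]⟩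

/-- Expand `y` in powers of an element with value outside `vK` and let `c` be the constant term. The
rest has the value of one of its terms, all of positive degree below `q`. -/
theorem exists_sub_val_notMem (hq : q.Prime) (he : (baseGroup K v).index = q)
    (hdeg : Module.finrank K L = q) {y : L} (hy : ∀ c : K, algebraMap K L c ≠ y) :
    ∃ c : K, val v (y - algebraMap K L c) ∉ baseGroup K v ∧ v y ≤ v (y - algebraMap K L c) := by
  obtain ⟨g, -, hg⟩ := exists_pos_notMem hq he
  obtain ⟨x, hx0, rfl⟩ := exists_val_eq v g
  obtain ⟨c, hc⟩ := exists_eq_sum_mul_pow hq he hdeg hg y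
  obtain ⟨n, rfl⟩ : ∃ n, q = n + 1 := ⟨q - 1, by have := hq.pos; omega⟩
  rw [Finset.sum_range_succ', pow_zero, mul_one] at hc
  set z := ∑ i ∈ Finset.range n, algebraMap K L (c (i + 1)) * x ^ (i + 1) with hz
  have hyz : y - algebraMap K L (c 0) = z := by rw [hc, add_sub_cancel_right]
  have hz0 : z ≠ 0 := fun h => hy (c 0) (sub_eq_zero.1 (hyz.trans h)).symm
  have hyle : ∀ i < n + 1, v y ≤ v (algebraMap K L (c i) * x ^ i) := fun i hi => by
    have h1 := addVal_sum_mul_pow_le hq he hg c hi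
    rwa [Finset.sum_range_succ', pow_zero, mul_one, ← hz, ← hc] at h1
  have hzle : ∀ i < n, v z ≤ v (algebraMap K L (c (i + 1)) * x ^ (i + 1)) := fun i hi =>
    addVal_sum_le v (Finset.range n) _ (fun a ha b hb hab h0 =>
      addVal_mul_pow_ne hq he hg c (by simpa using ha) (by simpa using hb) (by omega) h0)
      (Finset.mem_range.2 hi)
  refine ⟨c 0, ?_, ?_⟩
  · rw [hyz]
    obtain ⟨i, hi, hiz⟩ : ∃ i ∈ Finset.range n,
        v (algebraMap K L (c (i + 1)) * x ^ (i + 1)) ≤ v z := by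
      by_contra! hcon
      exact lt_irrefl _ (v.map_lt_sum (fun h => hz0 (v.top_iff.1 h)) hcon)
    have hi' := Finset.mem_range.1 hi
    have heq := le_antisymm hiz (hzle i hi')
    have ht0 : algebraMap K L (c (i + 1)) * x ^ (i + 1) ≠ 0 := by
      intro h
      rw [h, v.map_zero] at heq
      exact hz0 (v.top_iff.1 heq.symm)
    have hc0 : c (i + 1) ≠ 0 := by rintro h; simp [h] at ht0
    rw [← (val_eq_val_iff v ht0 hz0).2 heq]
    exact val_algebraMap_mul_notMem (val_pow_notMem hq he hg (by omega) (by omega)) hc0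
  · rw [hyz]
    exact v.map_le_sum fun i hi => hyle _ (by have := Finset.mem_range.1 hi; omega)

/-- A Kummer generator with value in `vK` can be normalized to a `1`-unit `η` such that
`v (η - 1) ∉ vK`. -/
theorem IsKummerGenerator.exists_isOneUnit (hq : q.Prime) (he : (baseGroup K v).index = q)
    (hK : IsKummerExtension K L q) {η : L} (hη : IsKummerGenerator K q η)
    (hηv : val v η ∈ baseGroup K v) :
    ∃ η' : L, IsKummerGenerator K q η' ∧ IsOneUnit v η' ∧ val v (η' - 1) ∉ baseGroup K v := by
  have hne := hη.notMem_range hq hK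
  have hη0 : η ≠ 0 := fun h => hne 0 (by rw [map_zero, h])
  obtain ⟨c, hcH, hcv⟩ := exists_sub_val_notMem hq he hK.finrank_eq hne
  have hz0 := ne_zero_of_val_notMem hcH
  have hlt : v η < v (η - algebraMap K L c) := by
    refine lt_of_le_of_ne hcv fun h => hcH ?_
    rwa [← (val_eq_val_iff v hη0 hz0).2 h]
  have hvc : v (algebraMap K L c) = v η := by
    have h1 := v.map_add_eq_of_lt_left (x := η) (y := -(η - algebraMap K L c))
      (by rwa [v.map_neg])
    rwa [neg_sub, add_sub_cancel] at h1
  have hc0' : algebraMap K L c ≠ 0 := by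
    intro h
    rw [h, v.map_zero] at hvc
    exact hη0 (v.top_iff.1 hvc.symm)
  have hc0 : c ≠ 0 := fun h => hc0' (by rw [h, map_zero])
  have hsub : algebraMap K L c⁻¹ * η - 1 = algebraMap K L c⁻¹ * (η - algebraMap K L c) := by
    rw [mul_sub, ← map_mul, inv_mul_cancel₀ hc0, map_one]
  have hnot : val v (algebraMap K L c⁻¹ * η - 1) ∉ baseGroup K v := by
    rw [hsub]
    exact val_algebraMap_mul_notMem hcH (inv_ne_zero hc0)
  refine ⟨algebraMap K L c⁻¹ * η, hη.algebraMap_mul (inv_ne_zero hc0), ?_, hnot⟩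
  have h0 := ne_zero_of_val_notMem hnot
  unfold IsOneUnit
  rw [← val_pos_iff v h0, hsub, map_inv₀, val_mul v (inv_ne_zero hc0') hz0, val_inv v hc0',
    (val_eq_val_iff v hc0' hη0).2 hvc, neg_add_eq_sub, sub_pos]
  exact (val_lt_val_iff v hη0 hz0).2 hlt

theorem IsOneUnit.addVal_eq_zero {η : L} (h : IsOneUnit v η) : v η = 0 := by
  have h1 := v.map_add_eq_of_lt_left (x := (1 : L)) (y := η - 1) (by rw [v.map_one]; exact h)
  rwa [add_sub_cancel, v.map_one] at h1

theorem addVal_one_sub_le_pow {u : L} (hu : 0 ≤ v u) (k : ℕ) : v (1 - u) ≤ v (1 - u ^ k) := by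
  rw [← mul_neg_geom_sum, v.map_mul]
  refine le_add_of_nonneg_right (v.map_le_sum fun i _ => ?_)
  rw [v.map_pow]
  exact nsmul_nonneg hu i

/-- `ζ` and `ζ ^ k` are powers of each other, so `1 - ζ` and `1 - ζ ^ k` divide each other in `O_L`.
-/
theorem addVal_one_sub_pow (hq : q.Prime) {ζ : L} (hζ : IsPrimitiveRoot ζ q) {k : ℕ}
    (hk : ζ ^ k ≠ 1) : v (1 - ζ ^ k) = v (1 - ζ) := by
  have h1 : v ζ = 0 := addVal_eq_zero_of_pow_eq_one hq.ne_zero hζ.pow_eq_one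
  refine le_antisymm ?_ (addVal_one_sub_le_pow h1.ge k)
  have hkq : k.Coprime q := by
    refine Nat.Coprime.symm ((Nat.Prime.coprime_iff_not_dvd hq).2 fun hdvd => hk ?_)
    exact (hζ.pow_eq_one_iff_dvd k).2 hdvd
  have : NeZero q := ⟨hq.ne_zero⟩
  obtain ⟨m, -, hm⟩ := (hζ.pow_of_coprime k hkq).eq_pow_of_pow_eq_one hζ.pow_eq_one
  have h2 := addVal_one_sub_le_pow (v := v) (u := ζ ^ k) (by rw [v.map_pow, h1, smul_zero]) m
  rwa [hm] at h2

/-- The conjugates of `ξ` differ from `ξ` by units. -/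
theorem addVal_algEquiv_kummerXi_sub (hq : q.Prime) {ζ : K} (hζ : IsPrimitiveRoot ζ q) {η : L}
    (hη : IsKummerGenerator K q η) (hη1 : IsOneUnit v η) {σ : L ≃ₐ[K] L} (hσ : σ η ≠ η) :
    v (σ (kummerXi ζ η) - kummerXi ζ η) = 0 := by
  have hvη := hη1.addVal_eq_zero
  have hη0 : η ≠ 0 := by
    rintro rfl
    exact hσ (map_zero σ)
  obtain ⟨-, a, ha⟩ := hη
  have hζL : IsPrimitiveRoot (algebraMap K L ζ) q :=
    hζ.map_of_injective (algebraMap K L).injective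
  have : NeZero q := ⟨hq.ne_zero⟩
  obtain ⟨k, -, hk⟩ := hζL.eq_pow_of_pow_eq_one (ξ := σ η / η) (by
    rw [div_pow, ← map_pow, ← ha, σ.commutes, div_self (by rw [ha]; exact pow_ne_zero q hη0)])
  rw [eq_div_iff hη0] at hk
  have hk1 : algebraMap K L ζ ^ k ≠ 1 := by
    intro h
    rw [h, one_mul] at hk
    exact hσ hk.symm
  have hne : (1 - algebraMap K L ζ) ≠ 0 := sub_ne_zero.2 (hζL.ne_one hq.one_lt).symm
  have hne' : (1 - algebraMap K L ζ ^ k) ≠ 0 := sub_ne_zero.2 hk1.symm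
  have heq : σ (kummerXi ζ η) - kummerXi ζ η =
      -(η * ((1 - algebraMap K L ζ ^ k) / (1 - algebraMap K L ζ))) := by
    unfold kummerXi
    rw [map_div₀, map_sub, map_sub, map_one, σ.commutes, ← hk]
    field_simp
    ring
  have h1 : v ((1 - algebraMap K L ζ ^ k) / (1 - algebraMap K L ζ)) = 0 := by
    rw [← val_eq_zero_iff v (div_ne_zero hne' hne), val_div v hne' hne, sub_eq_zero,
      val_eq_val_iff v hne' hne]
    exact addVal_one_sub_pow hq hζL hk1
  rw [heq, v.map_neg, v.map_mul, hvη, h1, add_zero]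

theorem IsKummerGenerator.exists_algEquiv_ne (hq : q.Prime) (hK : IsKummerExtension K L q) {η : L}
    (hη : IsKummerGenerator K q η) : ∃ σ : L ≃ₐ[K] L, σ η ≠ η := by
  have := hK.finiteDimensional hq
  have := hK.isGalois
  by_contra! hcon
  obtain ⟨c, hc⟩ := (IsGalois.mem_range_algebraMap_iff_fixed η).2 hcon
  exact hη.notMem_range hq hK c hc

theorem exists_kummerCaseII (hq : q.Prime) (he : (baseGroup K v).index = q)
    (hK : IsKummerExtension K L q) (hv : 0 < v (q : L)) {η : L} (hη : IsKummerGenerator K q η)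
    (hηv : val v η ∈ baseGroup K v) {ζ : K} (hζ : IsPrimitiveRoot ζ q) :
    ∃ (η : L) (j : ℕ), KummerCaseII v q ζ η j := by
  obtain ⟨η', hη', hη1, hηH⟩ := hη.exists_isOneUnit hq he hK hηv
  have hne : (1 - ζ) ≠ 0 := sub_ne_zero.2 (hζ.ne_one hq.one_lt).symm
  have hξeq : kummerXi ζ η' = algebraMap K L (1 - ζ)⁻¹ * (η' - 1) := by
    rw [kummerXi, map_inv₀, map_sub, map_one, div_eq_inv_mul]
  have hξ : val v (kummerXi ζ η') ∉ baseGroup K v := by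
    rw [hξeq]
    exact val_algebraMap_mul_notMem hηH (inv_ne_zero hne)
  have hξ0 := ne_zero_of_val_notMem hξ
  have hneg : v (kummerXi ζ η') < 0 := by
    rw [← val_neg_iff v hξ0]
    -- If `v ξ` were positive, so would be `v (σ ξ - ξ)`, yet conjugates of `ξ` differ by units.
    -- Value zero is impossible because `v ξ ∉ vK`.
    by_contra! hcon
    have hpos : 0 < v (kummerXi ζ η') := by
      rw [← val_pos_iff v hξ0]
      exact lt_of_le_of_ne hcon fun h => hξ (h ▸ zero_mem _)
    obtain ⟨σ, hσ⟩ := hη'.exists_algEquiv_ne hq hK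
    have h1 := addVal_algEquiv_kummerXi_sub hq hζ hη' hη1 hσ
    have h2 := v.map_sub (σ (kummerXi ζ η')) (kummerXi ζ η')
    rw [addVal_algEquiv hq he hK.finrank_eq, min_self, h1] at h2
    exact absurd hpos (not_lt.2 h2)
  obtain ⟨j, hj1, hjq, hgen⟩ := exists_pow_generatesValRing hq he hK.finrank_eq hξ
  refine ⟨η', j, charZero_of_addVal_pos hq (hK.natCast_ne_zero hq) hv,
    (charP_residueField_iff hq).2 hv, hη', hη1, hj1, by omega, hneg, ?_⟩
  simpa using hgen 1 one_ne_zero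

end

/-! ### Kähler differentials of a union of a chain of monogenic algebras. -/

section Differentials

open Polynomial

variable {R A ι : Type*} [CommRing R] [CommRing A] [Algebra R A]

/-- A family of generators `θ i` of `A | R`, totally ordered by divisibility in `R`, together with
weights `g i` that scale in the same way. -/
structure IsGeneratingChain (R : Type*) {A ι : Type*} [CommRing R] [CommRing A] [Algebra R A]
    (θ g : ι → A) : Prop where
  total : ∀ i j, ∃ r : R, (θ i = r • θ j ∧ g i = r • g j) ∨ (θ j = r • θ i ∧ g j = r • g i)
  mem_adjoin : ∀ a : A, ∃ i, a ∈ Algebra.adjoin R {θ i}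
  integral : ∀ i, IsIntegral R (θ i)
  ne_zero : ∀ i, g i ≠ 0

namespace IsGeneratingChain

variable {θ g : ι → A} (h : IsGeneratingChain R θ g)

include h

theorem exists_aeval_eq (a : A) : ∃ (i : ι) (f : R[X]), aeval (θ i) f = a := by
  obtain ⟨i, hi⟩ := h.mem_adjoin a
  rw [Algebra.adjoin_singleton_eq_range_aeval] at hi
  obtain ⟨f, hf⟩ := hi
  exact ⟨i, f, hf⟩

omit h in
-- Passing to a larger ring of the chain substitutes `r X`; the factor `r` from the chain rule is
-- compensated by the weights.
theorem aeval_comp_smul {i j : ι} {r : R} (hθ : θ i = r • θ j) (hg : g i = r • g j) (f : R[X]) :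
    aeval (θ j) (f.comp (C r * X)) = aeval (θ i) f ∧
      g j * aeval (θ j) (derivative (f.comp (C r * X))) = g i * aeval (θ i) (derivative f) := by
  have h1 : aeval (θ j) (C r * X) = θ i := by
    rw [map_mul, aeval_C, aeval_X, hθ, Algebra.smul_def]
  refine ⟨by rw [aeval_comp, h1], ?_⟩
  rw [derivative_comp, map_mul, aeval_comp, h1, derivative_C_mul, derivative_X, mul_one, aeval_C,
    ← mul_assoc, hg, Algebra.smul_def]
  ring

theorem exists_common (i j : ι) (f₁ f₂ : R[X]) : ∃ (k : ι) (f₁' f₂' : R[X]),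
    (aeval (θ k) f₁' = aeval (θ i) f₁ ∧
      g k * aeval (θ k) (derivative f₁') = g i * aeval (θ i) (derivative f₁)) ∧
    (aeval (θ k) f₂' = aeval (θ j) f₂ ∧
      g k * aeval (θ k) (derivative f₂') = g j * aeval (θ j) (derivative f₂)) := by
  obtain ⟨r, ⟨h1, h2⟩ | ⟨h1, h2⟩⟩ := h.total i j
  · exact ⟨j, _, f₂, aeval_comp_smul h1 h2 f₁, rfl, rfl⟩
  · exact ⟨i, f₁, _, ⟨rfl, rfl⟩, aeval_comp_smul h1 h2 f₂⟩

/-- Weights are comparable under divisibility, so a finite sum of multiples collapses to a multiple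
of a single one. -/
theorem exists_mul_eq_of_mem_span {x : A} (hx : x ∈ Ideal.span (Set.range g)) :
    ∃ (i : ι) (a : A), x = a * g i := by
  induction hx using Submodule.span_induction with
  | mem x hx =>
    obtain ⟨i, rfl⟩ := hx
    exact ⟨i, 1, (one_mul _).symm⟩
  | zero =>
    obtain ⟨i, -⟩ := h.mem_adjoin 0
    exact ⟨i, 0, (zero_mul _).symm⟩
  | add x y _ _ hx hy =>
    obtain ⟨i, a, rfl⟩ := hx
    obtain ⟨j, b, rfl⟩ := hy
    obtain ⟨r, ⟨-, h2⟩ | ⟨-, h2⟩⟩ := h.total i j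
    · exact ⟨j, a * algebraMap R A r + b, by rw [h2, Algebra.smul_def]; ring⟩
    · exact ⟨i, a + b * algebraMap R A r, by rw [h2, Algebra.smul_def]; ring⟩
  | smul b x _ hx =>
    obtain ⟨i, a, rfl⟩ := hx
    exact ⟨i, b * a, by rw [smul_eq_mul, mul_assoc]⟩

theorem exists_mul_pow_eq_of_mem_span_pow (n : ℕ) {x : A} (hx : x ∈ Ideal.span (Set.range g) ^ n) :
    ∃ (i : ι) (a : A), x = a * g i ^ n := by
  have hadd : ∀ (m : ℕ) (x y : A), (∃ (i : ι) (a : A), x = a * g i ^ m) →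
      (∃ (i : ι) (a : A), y = a * g i ^ m) → ∃ (i : ι) (a : A), x + y = a * g i ^ m := by
    rintro m _ _ ⟨i, a, rfl⟩ ⟨j, b, rfl⟩
    obtain ⟨r, ⟨-, h2⟩ | ⟨-, h2⟩⟩ := h.total i j
    · exact ⟨j, a * algebraMap R A r ^ m + b, by rw [h2, Algebra.smul_def]; ring⟩
    · exact ⟨i, a + b * algebraMap R A r ^ m, by rw [h2, Algebra.smul_def]; ring⟩
  induction n generalizing x with
  | zero =>
    obtain ⟨i, -⟩ := h.mem_adjoin 0
    exact ⟨i, x, by simp⟩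
  | succ n ih =>
    rw [pow_succ] at hx
    refine Submodule.mul_induction_on hx (fun y hy z hz => ?_) (hadd (n + 1))
    obtain ⟨i, a, rfl⟩ := ih hy
    obtain ⟨j, b, rfl⟩ := h.exists_mul_eq_of_mem_span hz
    obtain ⟨r, ⟨-, h2⟩ | ⟨-, h2⟩⟩ := h.total i j
    · exact ⟨j, a * algebraMap R A r ^ n * b, by rw [h2, Algebra.smul_def]; ring⟩
    · exact ⟨i, a * b * algebraMap R A r, by rw [h2, Algebra.smul_def]; ring⟩

section Kahler

variable [IsDomain R] [IsDomain A] [IsIntegrallyClosed R] [Module.IsTorsionFree R A] {N : Ideal A}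
  (hN : ∀ i, g i * aeval (θ i) (derivative (minpoly R (θ i))) ∈ N)

include hN

/-- Over a common index the two polynomials differ by a multiple of the minimal polynomial, whose
derivative at `θ k` is a multiple of the generator in `hN`. -/
theorem mk_mul_derivative_eq {i j : ι} {f₁ f₂ : R[X]} (hf : aeval (θ i) f₁ = aeval (θ j) f₂) :
    Ideal.Quotient.mk N (g i * aeval (θ i) (derivative f₁)) =
      Ideal.Quotient.mk N (g j * aeval (θ j) (derivative f₂)) := by
  obtain ⟨k, p₁, p₂, ⟨h1, h2⟩, h3, h4⟩ := h.exists_common i j f₁ f₂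
  rw [← h2, ← h4, Ideal.Quotient.eq, ← mul_sub, ← map_sub, ← derivative_sub]
  have h5 : aeval (θ k) (p₁ - p₂) = 0 := by rw [map_sub, h1, h3, hf, sub_self]
  obtain ⟨p, hp⟩ := minpoly.isIntegrallyClosed_dvd (h.integral k) h5
  rw [hp, derivative_mul, map_add, map_mul, map_mul, minpoly.aeval, zero_mul, add_zero,
    ← mul_assoc]
  exact N.mul_mem_right _ (hN k)

/-- The rule is independent of the representation, and two elements always have representations over
one index, so additivity and the Leibniz rule reduce to those for polynomials. -/
theorem exists_derivation : ∃ D : Derivation R A (A ⧸ N), ∀ (i : ι) (f : R[X]),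
    D (aeval (θ i) f) = Ideal.Quotient.mk N (g i * aeval (θ i) (derivative f)) := by
  choose ind pol hpol using h.exists_aeval_eq
  set D₀ : A → A ⧸ N := fun a =>
    Ideal.Quotient.mk N (g (ind a) * aeval (θ (ind a)) (derivative (pol a))) with hD₀
  have hD : ∀ (i : ι) (f : R[X]), D₀ (aeval (θ i) f) =
      Ideal.Quotient.mk N (g i * aeval (θ i) (derivative f)) := fun i f =>
    h.mk_mul_derivative_eq hN (hpol _)
  have hcommon : ∀ a b : A, ∃ (k : ι) (f₁ f₂ : R[X]), aeval (θ k) f₁ = a ∧ aeval (θ k) f₂ = b := by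
    intro a b
    obtain ⟨k, f₁, f₂, h1, h2⟩ := h.exists_common (ind a) (ind b) (pol a) (pol b)
    exact ⟨k, f₁, f₂, h1.1.trans (hpol a), h2.1.trans (hpol b)⟩
  refine ⟨Derivation.mk' { toFun := D₀, map_add' := ?_, map_smul' := ?_ } ?_, hD⟩
  · intro a b
    obtain ⟨k, f₁, f₂, rfl, rfl⟩ := hcommon a b
    rw [← map_add, hD, hD, hD, derivative_add, map_add, mul_add, map_add]
  · intro r a
    obtain ⟨k, f, rfl⟩ := h.exists_aeval_eq a
    rw [← map_smul, hD, hD, derivative_smul, map_smul, mul_smul_comm]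
    rfl
  · intro a b
    obtain ⟨k, f₁, f₂, rfl, rfl⟩ := hcommon a b
    change D₀ _ = _ • D₀ _ + _ • D₀ _
    rw [← map_mul, hD, hD, hD, Algebra.smul_def, Algebra.smul_def,
      Ideal.Quotient.algebraMap_eq, ← map_mul, ← map_mul, ← map_add]
    refine congrArg _ ?_
    rw [derivative_mul, map_add, map_mul, map_mul]
    ring

/-- The module of differentials of `A | R` is `I / N`, where `I` is generated by the weights `g i`
and `N` by the multiples `g i * h_i'(θ i)`, with `h_i` the minimal polynomial of `θ i`. -/
theorem nonempty_kaehlerDifferential_equiv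
    (hN' : ∀ x ∈ N, ∃ (i : ι) (a : A),
      x = a * (g i * aeval (θ i) (derivative (minpoly R (θ i))))) :
    Nonempty (Ω[A⁄R] ≃ₗ[A]
      (Ideal.span (Set.range g) ⧸ N.submoduleOf (Ideal.span (Set.range g)))) := by
  obtain ⟨D, hD⟩ := h.exists_derivation hN
  have hDθ : ∀ i, D (θ i) = Ideal.Quotient.mk N (g i) := fun i => by
    have h1 := hD i X
    rwa [aeval_X, derivative_X, map_one, mul_one] at h1
  choose ind coef hcoef using fun x : Ideal.span (Set.range g) =>
    h.exists_mul_eq_of_mem_span x.2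
  have hwd : ∀ (i j : ι) (a b : A), a * g i = b * g j →
      a • KaehlerDifferential.D R A (θ i) = b • KaehlerDifferential.D R A (θ j) := by
    have key : ∀ (i j : ι) (a b : A) (r : R), θ i = r • θ j → g i = r • g j → a * g i = b * g j →
        a • KaehlerDifferential.D R A (θ i) = b • KaehlerDifferential.D R A (θ j) := by
      intro i j a b r h1 h2 h3
      rw [h2, Algebra.smul_def, ← mul_assoc] at h3
      rw [h1, Derivation.map_smul, ← mul_right_cancel₀ (h.ne_zero j) h3, mul_smul, algebraMap_smul]
    intro i j a b hab
    obtain ⟨r, ⟨h1, h2⟩ | ⟨h1, h2⟩⟩ := h.total i j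
    · exact key i j a b r h1 h2 hab
    · exact (key j i b a r h1 h2 hab.symm).symm
  -- The map `a g_i ↦ a dθ_i`; `hwd` makes it independent of the chosen representation.
  set ψ₀ : Ideal.span (Set.range g) → Ω[A⁄R] := fun x =>
    coef x • KaehlerDifferential.D R A (θ (ind x)) with hψ₀
  have hψ : ∀ (x : Ideal.span (Set.range g)) (i : ι) (a : A), (x : A) = a * g i →
      ψ₀ x = a • KaehlerDifferential.D R A (θ i) := fun x i a hx =>
    hwd _ _ _ _ ((hcoef x).symm.trans hx)
  have hψadd : ∀ x y, ψ₀ (x + y) = ψ₀ x + ψ₀ y := by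
    have key : ∀ (x y : Ideal.span (Set.range g)) (i j : ι) (a b : A) (r : R),
        (x : A) = a * g i → (y : A) = b * g j → g i = r • g j → ψ₀ (x + y) = ψ₀ x + ψ₀ y := by
      intro x y i j a b r hx hy h2
      rw [h2, Algebra.smul_def, ← mul_assoc] at hx
      rw [hψ x j _ hx, hψ y j b hy, ← add_smul]
      exact hψ _ _ _ (by rw [Submodule.coe_add, hx, hy, add_mul])
    intro x y
    obtain ⟨r, ⟨-, h2⟩ | ⟨-, h2⟩⟩ := h.total (ind x) (ind y)
    · exact key x y _ _ _ _ r (hcoef x) (hcoef y) h2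
    · rw [add_comm x, add_comm (ψ₀ x)]
      exact key y x _ _ _ _ r (hcoef y) (hcoef x) h2
  let ψ : Ideal.span (Set.range g) →ₗ[A] Ω[A⁄R] :=
    { toFun := ψ₀
      map_add' := hψadd
      map_smul' := fun b x => by
        rw [hψ (b • x) (ind x) (b * coef x)
          (by rw [Submodule.coe_smul, smul_eq_mul, mul_assoc, ← hcoef x]), mul_smul]
        rfl }
  have hφψ : ∀ x, D.liftKaehlerDifferential (ψ x) = Ideal.Quotient.mk N (x : A) := by
    intro x
    change D.liftKaehlerDifferential (ψ₀ x) = _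
    rw [hψ x _ _ (hcoef x), map_smul, Derivation.liftKaehlerDifferential_comp_D, hDθ,
      Algebra.smul_def, Ideal.Quotient.algebraMap_eq, ← map_mul, ← hcoef x]
  -- Composing `ψ` with the map induced by `D` gives reduction modulo `N`, so the kernel lies in
  -- `N`. Conversely `a g_i h_i'(θ_i)` goes to `a d(h_i(θ_i)) = 0`.
  have hker : LinearMap.ker ψ = N.submoduleOf (Ideal.span (Set.range g)) := by
    ext x
    rw [LinearMap.mem_ker, Submodule.submoduleOf, Submodule.mem_comap, Submodule.subtype_apply]
    constructor
    · intro hx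
      have h1 := hφψ x
      rw [hx, map_zero, eq_comm, Ideal.Quotient.eq_zero_iff_mem] at h1
      exact h1
    · intro hx
      obtain ⟨i, a, ha⟩ := hN' x hx
      change ψ₀ x = 0
      rw [hψ x i (a * aeval (θ i) (derivative (minpoly R (θ i)))) (by rw [ha]; ring), mul_smul,
        ← Derivation.map_aeval, minpoly.aeval, map_zero, smul_zero]
  have hsurj : Function.Surjective ψ := by
    rw [← LinearMap.range_eq_top, eq_top_iff, ← KaehlerDifferential.span_range_derivation,
      Submodule.span_le]
    rintro _ ⟨a, rfl⟩
    obtain ⟨i, f, rfl⟩ := h.exists_aeval_eq a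
    refine ⟨⟨aeval (θ i) (derivative f) * g i,
      Ideal.mul_mem_left _ _ (Ideal.subset_span ⟨i, rfl⟩)⟩, ?_⟩
    rw [Derivation.map_aeval]
    exact hψ _ _ _ rfl
  rw [← hker]
  exact ⟨(ψ.quotKerEquivOfSurjective hsurj).symm⟩

end Kahler

end IsGeneratingChain

end Differentials

/-! ### The chain of the rings `O_K[c θ]` and derivatives of minimal polynomials. -/

section

open Polynomial

variable {K L Γ : Type*} [Field K] [Field L] [Algebra K L]
  [AddCommGroup Γ] [LinearOrder Γ] [IsOrderedAddMonoid Γ]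
  {v : AddValuation L (WithTop Γ)} {q : ℕ}

theorem exists_eq_mul_of_addVal_le {x y : valRing v} (hx : (x : L) ≠ 0) (hxy : v (x : L) ≤ v y) :
    ∃ a : valRing v, y = a * x := by
  by_cases hy : (y : L) = 0
  · exact ⟨0, by rw [zero_mul]; exact Subtype.ext hy⟩
  · refine ⟨⟨(y : L) / x, ?_⟩, Subtype.ext (div_mul_cancel₀ _ hx).symm⟩
    change 0 ≤ v ((y : L) / x)
    rw [← val_nonneg_iff v (div_ne_zero hy hx), val_div v hy hx, sub_nonneg,
      val_le_val_iff v hx hy]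
    exact hxy

instance : Module.IsTorsionFree (valRing (restrictVal K v)) (valRing v) := by
  refine Module.IsTorsionFree.of_smul_eq_zero fun r x hrx => ?_
  rw [Algebra.smul_def, mul_eq_zero] at hrx
  refine hrx.imp_left fun h => Subtype.ext ?_
  have h1 : algebraMap K L (r : K) = 0 := congrArg Subtype.val h
  exact (map_eq_zero _).1 h1

/-- The admissible multipliers `c` in `O_L = ⋃ O_K[c θ]`. -/
abbrev Multiplier (K : Type*) {L Γ : Type*} [Field K] [Field L] [Algebra K L]
    [AddCommGroup Γ] [LinearOrder Γ] [IsOrderedAddMonoid Γ]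
    (v : AddValuation L (WithTop Γ)) (θ : L) : Type _ :=
  {c : K // c ≠ 0 ∧ 0 < v (algebraMap K L c * θ)}

/-- The element `c θ` of `O_L`. -/
def Multiplier.gen {θ : L} (c : Multiplier K v θ) : valRing v :=
  ⟨algebraMap K L c.1 * θ, c.2.2.le⟩

/-- The element `c s` of `O_L`. -/
def Multiplier.weight {θ s : L}
    (hs : ∀ c : Multiplier K v θ, 0 ≤ v (algebraMap K L c.1 * s)) (c : Multiplier K v θ) :
    valRing v :=
  ⟨algebraMap K L c.1 * s, hs c⟩

/-- Any two multipliers have a quotient in `O_K`, one way or the other, and it scales `c θ` and `c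
s` alike. -/
theorem isGeneratingChain_multiplier [IsGalois K L] (hq : q.Prime)
    (he : (baseGroup K v).index = q) (hdeg : Module.finrank K L = q) {θ s : L}
    (hgen : GeneratesValRing K v θ) (hs0 : s ≠ 0)
    (hs : ∀ c : Multiplier K v θ, 0 ≤ v (algebraMap K L c.1 * s)) :
    IsGeneratingChain (valRing (restrictVal K v)) (Multiplier.gen (K := K) (v := v) (θ := θ))
      (Multiplier.weight hs) where
  total := by
    have key : ∀ c d : Multiplier K v θ,
        v (algebraMap K L c.1) ≤ v (algebraMap K L d.1) →
        ∃ r : valRing (restrictVal K v), d.gen = r • c.gen ∧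
          d.weight hs = r • c.weight hs := by
      intro c d hcd
      have hc0 : algebraMap K L c.1 ≠ 0 := (_root_.map_ne_zero _).2 c.2.1
      have hd0 : algebraMap K L d.1 ≠ 0 := (_root_.map_ne_zero _).2 d.2.1
      have hr : 0 ≤ restrictVal K v (d.1 / c.1) := by
        rw [restrictVal_apply, map_div₀, ← val_nonneg_iff v (div_ne_zero hd0 hc0),
          val_div v hd0 hc0, sub_nonneg, val_le_val_iff v hc0 hd0]
        exact hcd
      have hmul : ∀ t : L, algebraMap K L d.1 * t =
          algebraMap K L (d.1 / c.1) * (algebraMap K L c.1 * t) := fun t => by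
        rw [map_div₀, ← mul_assoc, div_mul_cancel₀ _ hc0]
      refine ⟨⟨d.1 / c.1, hr⟩, ?_, ?_⟩ <;> rw [Algebra.smul_def]
      · exact Subtype.ext (hmul θ)
      · exact Subtype.ext (hmul s)
    intro c d
    rcases le_total (v (algebraMap K L c.1)) (v (algebraMap K L d.1)) with h | h
    · obtain ⟨r, hr⟩ := key c d h
      exact ⟨r, Or.inr hr⟩
    · obtain ⟨r, hr⟩ := key d c h
      exact ⟨r, Or.inl hr⟩
  mem_adjoin a := by
    obtain ⟨c, hc, hc', hmem⟩ := generatesValRing_iff.1 hgen a a.2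
    refine ⟨⟨c, hc, hc'⟩, ?_⟩
    have h1 : IsScalarTower.toAlgHom (valRing (restrictVal K v)) (valRing v) L a ∈
        (Algebra.adjoin (valRing (restrictVal K v))
          {Multiplier.gen (⟨c, hc, hc'⟩ : Multiplier K v θ)}).map
          (IsScalarTower.toAlgHom (valRing (restrictVal K v)) (valRing v) L) := by
      rw [AlgHom.map_adjoin_singleton]
      exact hmem
    obtain ⟨b, hb, hba⟩ := h1
    have : b = a := Subtype.ext hba
    exact this ▸ hb
  integral c := by
    rw [← isIntegral_algebraMap_iff (B := L) (Subtype.val_injective)]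
    exact isIntegral_of_addVal_nonneg hq he hdeg c.2.2.le
  ne_zero c h := mul_ne_zero ((_root_.map_ne_zero _).2 c.2.1) hs0 (congrArg Subtype.val h)

/-- `O_K` is integrally closed, so the minimal polynomials over `O_K` and over `K` agree. -/
theorem coe_aeval_derivative_minpoly {x : valRing v}
    (hx : IsIntegral (valRing (restrictVal K v)) x) :
    ((aeval x (derivative (minpoly (valRing (restrictVal K v)) x)) : valRing v) : L) =
      aeval (x : L) (derivative (minpoly K (x : L))) := by
  have h1 : minpoly K (x : L) = (minpoly (valRing (restrictVal K v)) x).map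
      (algebraMap (valRing (restrictVal K v)) K) :=
    minpoly.isIntegrallyClosed_eq_field_fractions K L hx
  rw [h1, derivative_map, aeval_map_algebraMap]
  exact (aeval_algebraMap_apply L x _).symm

theorem GeneratesValRing.adjoin_eq_top {θ : L} (h : GeneratesValRing K v θ) :
    IntermediateField.adjoin K {θ} = ⊤ := by
  have key : ∀ y : L, 0 ≤ v y → y ∈ IntermediateField.adjoin K {θ} := by
    intro y hy
    obtain ⟨c, -, -, hmem⟩ := generatesValRing_iff.1 h y hy
    clear hy
    induction hmem using Algebra.adjoin_induction with
    | mem z hz =>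
      rw [Set.mem_singleton_iff.1 hz]
      exact mul_mem (IntermediateField.algebraMap_mem _ _)
        (IntermediateField.mem_adjoin_simple_self K θ)
    | algebraMap r => exact IntermediateField.algebraMap_mem _ (r : K)
    | add a b _ _ ha hb => exact add_mem ha hb
    | mul a b _ _ ha hb => exact mul_mem ha hb
  refine eq_top_iff.2 fun y _ => ?_
  rcases (valRing v).mem_or_inv_mem y with hy | hy
  · exact key y hy
  · simpa using inv_mem (key _ hy)

theorem natDegree_minpoly_of_adjoin_eq_top [FiniteDimensional K L] {x : L}
    (hx : IntermediateField.adjoin K {x} = ⊤) :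
    (minpoly K x).natDegree = Module.finrank K L := by
  rw [← IntermediateField.adjoin.finrank (Algebra.IsIntegral.isIntegral x), hx,
    IntermediateField.finrank_top']

theorem aeval_derivative_minpoly_of_pow_eq [FiniteDimensional K L] (hq : q ≠ 0)
    (hdeg : Module.finrank K L = q) {x : L} (hx : IntermediateField.adjoin K {x} = ⊤) {b : K}
    (hb : algebraMap K L b = x ^ q) :
    aeval x (derivative (minpoly K x)) = (q : L) * x ^ (q - 1) := by
  have h1 : minpoly K x ∣ X ^ q - C b := minpoly.dvd K x (by simp [hb])
  have h2 := eq_of_monic_of_dvd_of_natDegree_le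
    (minpoly.monic (Algebra.IsIntegral.isIntegral x)) (monic_X_pow_sub_C b hq) h1
    (by rw [natDegree_X_pow_sub_C, natDegree_minpoly_of_adjoin_eq_top hx, hdeg])
  rw [← h2, derivative_sub, derivative_C, sub_zero, derivative_X_pow, map_mul, aeval_C, map_pow,
    aeval_X, map_natCast]

/-- The cofactor `1 + u + ⋯ + u ^ (j - 1)` is congruent to `j` modulo the maximal ideal, hence a
unit. -/
theorem addVal_one_sub_pow_of_unit {u : L} (hu : 0 < v (1 - u)) {j : ℕ} (hj : v (j : L) = 0) :
    v (1 - u ^ j) = v (1 - u) := by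
  have hu0 : 0 ≤ v u := by
    have := sub_mem (one_mem (valRing v)) (show 1 - u ∈ valRing v from hu.le)
    rw [sub_sub_cancel] at this
    exact this
  have h1 : ∑ i ∈ Finset.range j, u ^ i = j + ∑ i ∈ Finset.range j, -(1 - u ^ i) := by
    simp
  have h2 : v (∑ i ∈ Finset.range j, u ^ i) = 0 := by
    rw [h1, ← hj]
    refine v.map_add_eq_of_lt_left ?_
    rw [hj]
    refine lt_of_lt_of_le hu (v.map_le_sum fun i _ => ?_)
    rw [v.map_neg]
    exact addVal_one_sub_le_pow hu0 i
  rw [← mul_neg_geom_sum, v.map_mul, h2, add_zero]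

/-- The quotient `y / x` is a `1`-unit with `v (1 - y / x) = -v x`; raising it to the power `j`
preserves this value. -/
theorem addVal_pow_sub_pow {x y : L} (hx : v x < 0) (hxy : v (y - x) = 0) {j : ℕ} (hj0 : 1 ≤ j)
    (hj : v (j : L) = 0) : v (x ^ j - y ^ j) = v (x ^ (j - 1)) := by
  have hx0 : x ≠ 0 := by
    rintro rfl
    rw [v.map_zero] at hx
    exact not_top_lt hx
  have hxy0 : x - y ≠ 0 := by
    intro h
    rw [← neg_sub, h, neg_zero, v.map_zero] at hxy
    exact WithTop.top_ne_zero hxy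
  have hxy' : v (x - y) = 0 := by rw [← neg_sub, v.map_neg, hxy]
  have h1 : 1 - y / x = (x - y) / x := by rw [sub_div, div_self hx0]
  have h2 : 0 < v (1 - y / x) := by
    rw [h1, ← val_pos_iff v (div_ne_zero hxy0 hx0), val_div v hxy0 hx0,
      (val_eq_zero_iff v hxy0).2 hxy', zero_sub]
    exact neg_pos.2 ((val_neg_iff v hx0).2 hx)
  have h3 : x ^ j - y ^ j = x ^ j * (1 - (y / x) ^ j) := by
    rw [div_pow, mul_sub, mul_one, mul_div_cancel₀ _ (pow_ne_zero j hx0)]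
  have h4 : x ^ (j - 1) * (x - y) = x ^ j * (1 - y / x) := by
    rw [h1, ← Nat.sub_add_cancel hj0, pow_succ, Nat.add_sub_cancel]
    field_simp
  rw [h3, v.map_mul, addVal_one_sub_pow_of_unit h2 hj, ← v.map_mul, ← h4, v.map_mul, hxy',
    add_zero]

theorem addVal_multiset_prod_map {α : Type*} (s : Multiset α) (f : α → L) {γ : WithTop Γ}
    (h : ∀ a ∈ s, v (f a) = γ) : v (s.map f).prod = Multiset.card s • γ := by
  induction s using Multiset.induction_on with
  | empty => simp
  | cons a s ih =>
    rw [Multiset.map_cons, Multiset.prod_cons, v.map_mul, h a (Multiset.mem_cons_self a s),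
      ih fun b hb => h b (Multiset.mem_cons_of_mem hb), Multiset.card_cons, succ_nsmul, add_comm]

/-- The derivative at `x` is the product of the differences `x - σ x` over the other conjugates,
each of value `γ`. -/
theorem addVal_aeval_derivative_minpoly [FiniteDimensional K L] [IsGalois K L] {x : L}
    {γ : WithTop Γ} (h : ∀ σ : L ≃ₐ[K] L, σ x ≠ x → v (x - σ x) = γ) :
    v (aeval x (derivative (minpoly K x))) = ((minpoly K x).natDegree - 1) • γ := by
  classical
  have hint : IsIntegral K x := Algebra.IsIntegral.isIntegral x
  have hsplit := Normal.splits (inferInstance : Normal K L) x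
  have hmon : ((minpoly K x).map (algebraMap K L)).Monic := (minpoly.monic hint).map _
  have hroot : x ∈ ((minpoly K x).map (algebraMap K L)).roots := by
    rw [mem_roots hmon.ne_zero, IsRoot.def, eval_map_algebraMap, minpoly.aeval]
  have hnodup : ((minpoly K x).map (algebraMap K L)).roots.Nodup :=
    nodup_roots (Separable.map (Algebra.IsSeparable.isSeparable K x))
  rw [← eval_map_algebraMap, ← derivative_map, hsplit.eval_root_derivative hmon hroot,
    addVal_multiset_prod_map (γ := γ), Multiset.card_erase_of_mem hroot,
    ← hsplit.natDegree_eq_card_roots, natDegree_map]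
  · rfl
  · intro a ha
    rw [hnodup.mem_erase_iff] at ha
    obtain ⟨hax, ha⟩ := ha
    rw [mem_roots hmon.ne_zero, IsRoot.def, eval_map_algebraMap] at ha
    obtain ⟨σ, rfl⟩ := minpoly.exists_algEquiv_of_root' (Algebra.IsAlgebraic.isAlgebraic x) ha
    exact h σ hax

end

/-! ### Case (i): the module of differentials and its vanishing. -/

section

open Polynomial

variable {K L Γ : Type*} [Field K] [Field L] [Algebra K L]
  [AddCommGroup Γ] [LinearOrder Γ] [IsOrderedAddMonoid Γ]
  {v : AddValuation L (WithTop Γ)} {q : ℕ}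

theorem ne_zero_of_addVal_neg {x : L} (hx : v x < 0) : x ≠ 0 := by
  rintro rfl
  rw [v.map_zero] at hx
  exact not_top_lt hx

theorem kummerIdealI_eq_span_range (η : L) :
    kummerIdealI K v η =
      Ideal.span (Set.range (Multiplier.weight (fun c : Multiplier K v η => c.2.2.le))) := by
  refine le_antisymm (Ideal.span_le.2 ?_) (Ideal.span_mono ?_)
  · rintro x ⟨c, hc, hx⟩
    by_cases hc0 : c = 0
    · have : x = 0 := Subtype.ext (by rw [hx, hc0, map_zero, zero_mul]; rfl)
      rw [this]
      exact Submodule.zero_mem _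
    · exact Ideal.subset_span ⟨⟨c, hc0, hc⟩, Subtype.ext hx.symm⟩
  · rintro _ ⟨c, rfl⟩
    exact ⟨c.1, c.2.2, rfl⟩

theorem KummerCaseI.isGeneratingChain (hq : q.Prime) (he : (baseGroup K v).index = q)
    (hK : IsKummerExtension K L q) {η : L} (h : KummerCaseI K v q η) :
    IsGeneratingChain (valRing (restrictVal K v)) (Multiplier.gen (K := K) (v := v) (θ := η))
      (Multiplier.weight (fun c : Multiplier K v η => c.2.2.le)) :=
  have := hK.isGalois
  isGeneratingChain_multiplier hq he hK.finrank_eq h.generates (ne_zero_of_addVal_neg h.neg) _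

/-- The minimal polynomial of `c η` is `X ^ q - (c η) ^ q`, and the weight supplies the missing
power of `c η`. -/
theorem KummerCaseI.weight_mul_derivative (hq : q.Prime) (he : (baseGroup K v).index = q)
    (hK : IsKummerExtension K L q) {η : L} (h : KummerCaseI K v q η) (c : Multiplier K v η) :
    c.weight (fun c : Multiplier K v η => c.2.2.le) *
      aeval c.gen (derivative (minpoly (valRing (restrictVal K v)) c.gen)) =
      (q : valRing v) * c.weight (fun c : Multiplier K v η => c.2.2.le) ^ q := by
  have := hK.finiteDimensional hq
  obtain ⟨a, ha⟩ := h.generator.2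
  have h1 := aeval_derivative_minpoly_of_pow_eq hq.ne_zero hK.finrank_eq
    (adjoin_algebraMap_mul_eq_top h.generator.1 c.2.1) (b := c.1 ^ q * a)
    (by rw [map_mul, map_pow, ha, mul_pow])
  refine Subtype.ext ?_
  have h2 := coe_aeval_derivative_minpoly ((h.isGeneratingChain hq he hK).integral c)
  change algebraMap K L c.1 * η * ((aeval c.gen (derivative
    (minpoly (valRing (restrictVal K v)) c.gen)) : valRing v) : L) =
      (q : L) * (algebraMap K L c.1 * η) ^ q
  rw [h2]
  change algebraMap K L c.1 * η * aeval (algebraMap K L c.1 * η)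
    (derivative (minpoly K (algebraMap K L c.1 * η))) = _
  rw [h1]
  obtain ⟨n, rfl⟩ : ∃ n, q = n + 1 := ⟨q - 1, by have := hq.pos; omega⟩
  rw [Nat.add_sub_cancel, pow_succ]
  ring

theorem KummerCaseI.exists_of_mem (hq : q.Prime) (he : (baseGroup K v).index = q)
    (hK : IsKummerExtension K L q) {η : L} (h : KummerCaseI K v q η) {x : valRing v}
    (hx : x ∈ Ideal.span {(q : valRing v)} * kummerIdealI K v η ^ q) :
    ∃ (c : Multiplier K v η) (a : valRing v),
      x = a * ((q : valRing v) * c.weight (fun c : Multiplier K v η => c.2.2.le) ^ q) := by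
  rw [kummerIdealI_eq_span_range, Ideal.mem_span_singleton_mul] at hx
  obtain ⟨z, hz, rfl⟩ := hx
  obtain ⟨c, a, rfl⟩ := (h.isGeneratingChain hq he hK).exists_mul_pow_eq_of_mem_span_pow q hz
  exact ⟨c, a, by ring⟩

theorem weight_mem_kummerIdealI {η : L} (c : Multiplier K v η) :
    c.weight (fun c : Multiplier K v η => c.2.2.le) ∈ kummerIdealI K v η :=
  Ideal.subset_span ⟨c.1, c.2.2, rfl⟩

theorem KummerCaseI.kaehlerDifferential_equiv (hq : q.Prime) (he : (baseGroup K v).index = q)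
    (hK : IsKummerExtension K L q) {η : L} (h : KummerCaseI K v q η) :
    Nonempty (Ω[valRing v⁄valRing (restrictVal K v)] ≃ₗ[valRing v]
      (kummerIdealI K v η ⧸ (Ideal.span {(q : valRing v)} * kummerIdealI K v η ^ q).submoduleOf
        (kummerIdealI K v η))) := by
  have hchain := h.isGeneratingChain hq he hK
  have hequiv := hchain.nonempty_kaehlerDifferential_equiv
    (N := Ideal.span {(q : valRing v)} * kummerIdealI K v η ^ q) (fun c => by
      rw [h.weight_mul_derivative hq he hK]
      exact Ideal.mul_mem_mul (Ideal.mem_span_singleton_self _)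
        (Ideal.pow_mem_pow (weight_mem_kummerIdealI c) q)) (fun x hx => by
      obtain ⟨c, a, hca⟩ := h.exists_of_mem hq he hK hx
      exact ⟨c, a, by rw [hca, h.weight_mul_derivative hq he hK]⟩)
  rwa [← kummerIdealI_eq_span_range] at hequiv

theorem subsingleton_quotient_submoduleOf_iff {A : Type*} [CommRing A] (I N : Ideal A) :
    Subsingleton (I ⧸ N.submoduleOf I) ↔ I ≤ N := by
  rw [Submodule.Quotient.subsingleton_iff, Submodule.submoduleOf,
    Submodule.comap_subtype_eq_top]

theorem mem_valSet_kummerIdealI_iff (hq : q.Prime) (he : (baseGroup K v).index = q)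
    (hK : IsKummerExtension K L q) {η : L} (h : KummerCaseI K v q η) {γ : valGroup v} :
    γ ∈ valSet v (kummerIdealI K v η) ↔
      ∃ β : valGroup v, 0 < β ∧ β - val v η ∈ baseGroup K v ∧ β ≤ γ := by
  have hη0 := ne_zero_of_addVal_neg h.neg
  constructor
  · rintro ⟨x, hx, hx0, rfl⟩
    rw [kummerIdealI_eq_span_range] at hx
    obtain ⟨c, a, rfl⟩ := (h.isGeneratingChain hq he hK).exists_mul_eq_of_mem_span hx
    have hc0 : algebraMap K L c.1 ≠ 0 := (_root_.map_ne_zero _).2 c.2.1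
    have hcη : algebraMap K L c.1 * η ≠ 0 := mul_ne_zero hc0 hη0
    have hmul : ((a * c.weight (fun c : Multiplier K v η => c.2.2.le) : valRing v) : L) =
      (a : L) * (algebraMap K L c.1 * η) := rfl
    rw [hmul] at hx0 ⊢
    have ha0 : (a : L) ≠ 0 := left_ne_zero_of_mul hx0
    refine ⟨val v (algebraMap K L c.1 * η), (val_pos_iff v hcη).2 c.2.2, ?_, ?_⟩
    · rw [val_mul v hc0 hη0, add_sub_cancel_right]
      exact val_algebraMap_mem v c.2.1
    · rw [val_mul v ha0 hcη]
      exact le_add_of_nonneg_left ((val_nonneg_iff v ha0).2 a.2)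
  · rintro ⟨β, hβ0, hβ, hγ⟩
    obtain ⟨c, hc, rfl⟩ := exists_mul_val_eq hη0 hβ
    have hcη : algebraMap K L c * η ≠ 0 := mul_ne_zero ((_root_.map_ne_zero _).2 hc) hη0
    have hpos := (val_pos_iff v hcη).1 hβ0
    obtain ⟨y, hy0, rfl⟩ := exists_val_eq v γ
    have hypos : 0 ≤ v y := hpos.le.trans ((val_le_val_iff v hcη hy0).1 hγ)
    refine ⟨⟨y, hypos⟩, ?_, hy0, rfl⟩
    obtain ⟨a, ha⟩ := exists_eq_mul_of_addVal_le (x := ⟨algebraMap K L c * η, hpos.le⟩)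
      (y := ⟨y, hypos⟩) hcη ((val_le_val_iff v hcη hy0).1 hγ)
    rw [ha]
    exact Ideal.mul_mem_left _ _ (Ideal.subset_span ⟨c, hpos, rfl⟩)

/-- Every element of `q I ^ q` is a multiple of a single `q (d η) ^ q`, so the inclusion can be read
off the values of the generators `c η`. -/
theorem kummerIdealI_le_iff (hq : q.Prime) (he : (baseGroup K v).index = q)
    (hK : IsKummerExtension K L q) {η : L} (h : KummerCaseI K v q η) :
    kummerIdealI K v η ≤ Ideal.span {(q : valRing v)} * kummerIdealI K v η ^ q ↔
      ∀ β : valGroup v, 0 < β → β - val v η ∈ baseGroup K v →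
        ∃ β' : valGroup v, 0 < β' ∧ β' - val v η ∈ baseGroup K v ∧
          val v (q : L) + q • β' ≤ β := by
  have hη0 := ne_zero_of_addVal_neg h.neg
  have hq0 : (q : L) ≠ 0 := by
    rw [← map_natCast (algebraMap K L)]
    exact (_root_.map_ne_zero _).2 (hK.natCast_ne_zero hq)
  have hval : ∀ c : Multiplier K v η, algebraMap K L c.1 * η ≠ 0 ∧
      0 < val v (algebraMap K L c.1 * η) ∧
      val v (algebraMap K L c.1 * η) - val v η ∈ baseGroup K v := by
    intro c
    have hc0 : algebraMap K L c.1 ≠ 0 := (_root_.map_ne_zero _).2 c.2.1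
    refine ⟨mul_ne_zero hc0 hη0, (val_pos_iff v (mul_ne_zero hc0 hη0)).2 c.2.2, ?_⟩
    rw [val_mul v hc0 hη0, add_sub_cancel_right]
    exact val_algebraMap_mem v c.2.1
  constructor
  · intro hle β hβ0 hβ
    obtain ⟨c, hc, rfl⟩ := exists_mul_val_eq hη0 hβ
    have hcη : algebraMap K L c * η ≠ 0 := mul_ne_zero ((_root_.map_ne_zero _).2 hc) hη0
    obtain ⟨d, a, hd⟩ := h.exists_of_mem hq he hK
      (hle (weight_mem_kummerIdealI ⟨c, hc, (val_pos_iff v hcη).1 hβ0⟩))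
    obtain ⟨hd0, hdpos, hdH⟩ := hval d
    refine ⟨_, hdpos, hdH, ?_⟩
    have heq : algebraMap K L c * η = (a : L) * ((q : L) * (algebraMap K L d.1 * η) ^ q) :=
      congrArg Subtype.val hd
    have ha0 : (a : L) ≠ 0 := by
      intro h0
      rw [heq, h0, zero_mul] at hcη
      exact hcη rfl
    have hp0 := pow_ne_zero q hd0
    rw [heq, val_mul v ha0 (mul_ne_zero hq0 hp0), val_mul v hq0 hp0, val_pow v hd0]
    exact le_add_of_nonneg_left ((val_nonneg_iff v ha0).2 a.2)
  · intro hA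
    rw [kummerIdealI_eq_span_range, Ideal.span_le]
    rintro _ ⟨c, rfl⟩
    obtain ⟨hc0, hcpos, hcH⟩ := hval c
    obtain ⟨β', h1, h2, h3⟩ := hA _ hcpos hcH
    obtain ⟨d, hd, rfl⟩ := exists_mul_val_eq hη0 h2
    have hd0 : algebraMap K L d * η ≠ 0 := mul_ne_zero ((_root_.map_ne_zero _).2 hd) hη0
    let d' : Multiplier K v η := ⟨d, hd, (val_pos_iff v hd0).1 h1⟩
    have hp0 := pow_ne_zero q hd0
    obtain ⟨a, ha⟩ := exists_eq_mul_of_addVal_le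
      (x := (q : valRing v) * d'.weight (fun c : Multiplier K v η => c.2.2.le) ^ q)
      (y := c.weight (fun c : Multiplier K v η => c.2.2.le)) (mul_ne_zero hq0 hp0) (by
        refine (val_le_val_iff v (mul_ne_zero hq0 hp0) hc0).1 ?_
        rw [val_mul v hq0 hp0, val_pow v hd0]
        exact h3)
    rw [ha, ← kummerIdealI_eq_span_range]
    exact Ideal.mul_mem_left _ _ (Ideal.mul_mem_mul (Ideal.mem_span_singleton_self _)
      (Ideal.pow_mem_pow (weight_mem_kummerIdealI d') q))

theorem not_isDiscretelyOrdered_archComponent_restrict_iff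
    {δ : valGroup (restrictVal K v)} {γ : valGroup v} (hγ : 0 < γ) (hδγ : (δ : Γ) = γ) :
    ¬ IsDiscretelyOrdered (ArchComponent δ) ↔ ∀ N : ℕ, ∃ h ∈ baseGroup K v,
      0 < h ∧ N • h ≤ γ ∧ ∃ m : ℕ, γ ≤ m • h := by
  have hle : ∀ x : Γ, x ∈ valGroup (restrictVal K v) → x ∈ valGroup v := by
    rintro x ⟨c, hc⟩
    exact ⟨_, hc⟩
  have hδ : 0 < δ := by
    rw [← Subtype.coe_lt_coe, hδγ]
    exact hγ
  rw [not_isDiscretelyOrdered_archComponent_iff hδ]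
  refine forall_congr' fun N => ⟨?_, ?_⟩
  · rintro ⟨h, h0, h1, m, h2⟩
    rw [← Subtype.coe_le_coe, hδγ] at h1 h2
    exact ⟨⟨h.1, hle _ h.2⟩, h.2, h0, h1, m, h2⟩
  · rintro ⟨h, hH, h0, h1, m, h2⟩
    refine ⟨⟨h.1, hH⟩, h0, ?_, m, ?_⟩
    · rw [← Subtype.coe_le_coe, hδγ]; exact h1
    · rw [← Subtype.coe_le_coe, hδγ]; exact h2

/-- Within the proof, `hC`, `hCP` and `hδ` translate the conditions on `C`, `C⁺` and the archimedean
component into the hypotheses of the coset criterion, with `t = v q` and `H = vK`. -/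
theorem KummerCaseI.subsingleton_iff (hq : q.Prime) (he : (baseGroup K v).index = q)
    (hK : IsKummerExtension K L q) {η : L} (h : KummerCaseI K v q η) :
    Subsingleton (Ω[valRing v⁄valRing (restrictVal K v)]) ↔
      valSet v (kummerIdealI K v η) ∩ convexC (val v (q : L)) = ∅ ∧
      ∀ c : K, c ≠ 0 → 0 < v (algebraMap K L c * η) →
        valSet v (kummerIdealI K v η) ∩ convexCPlus (val v (algebraMap K L c * η)) = ∅ →
        ∃ δ : valGroup (restrictVal K v),
          (δ : Γ) = q • (val v (algebraMap K L c * η) : Γ) ∧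
          ¬ IsDiscretelyOrdered (ArchComponent δ) := by
  have hη0 := ne_zero_of_addVal_neg h.neg
  have hq0 : (q : L) ≠ 0 := by
    rw [← map_natCast (algebraMap K L)]
    exact (_root_.map_ne_zero _).2 (hK.natCast_ne_zero hq)
  have ht : 0 ≤ val v (q : L) := (val_nonneg_iff v hq0).2 (addVal_natCast_nonneg v q)
  obtain ⟨e⟩ := h.kaehlerDifferential_equiv hq he hK
  rw [e.toEquiv.subsingleton_congr, subsingleton_quotient_submoduleOf_iff,
    kummerIdealI_le_iff hq he hK h]
  have hC : valSet v (kummerIdealI K v η) ∩ convexC (val v (q : L)) = ∅ ↔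
      ∀ β : valGroup v, 0 < β → β - val v η ∈ baseGroup K v → ∀ n : ℕ, n • val v (q : L) < β := by
    rw [Set.eq_empty_iff_forall_notMem]
    constructor
    · intro hemp β hβ0 hβ n
      by_contra! hcon
      refine hemp β ⟨(mem_valSet_kummerIdealI_iff hq he hK h).2 ⟨β, hβ0, hβ, le_rfl⟩, ?_⟩
      exact mem_convexC_iff.2 ⟨n, by rwa [abs_of_pos hβ0, abs_of_nonneg ht]⟩
    · rintro hall γ ⟨hγ, hγC⟩
      obtain ⟨β, hβ0, hβ, hle⟩ := (mem_valSet_kummerIdealI_iff hq he hK h).1 hγ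
      obtain ⟨n, hn⟩ := mem_convexC_iff.1 hγC
      rw [abs_of_pos (hβ0.trans_le hle), abs_of_nonneg ht] at hn
      exact absurd (hle.trans hn) (not_le.2 (hall β hβ0 hβ n))
  have hCP : ∀ β : valGroup v, 0 < β →
      (valSet v (kummerIdealI K v η) ∩ convexCPlus β = ∅ ↔
        ∀ σ : valGroup v, 0 < σ → σ - val v η ∈ baseGroup K v → ∃ n : ℕ, β ≤ n • σ) := by
    intro β hβ0
    rw [Set.eq_empty_iff_forall_notMem]
    constructor
    · intro hemp σ hσ0 hσ
      by_contra! hcon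
      refine hemp σ ⟨(mem_valSet_kummerIdealI_iff hq he hK h).2 ⟨σ, hσ0, hσ, le_rfl⟩, ?_⟩
      exact (mem_convexCPlus_iff hβ0.ne').2 fun n => by
        rw [abs_of_pos hσ0, abs_of_pos hβ0]; exact hcon n
    · rintro hall γ ⟨hγ, hγC⟩
      obtain ⟨σ, hσ0, hσ, hle⟩ := (mem_valSet_kummerIdealI_iff hq he hK h).1 hγ
      obtain ⟨n, hn⟩ := hall σ hσ0 hσ
      have h1 := (mem_convexCPlus_iff hβ0.ne').1 hγC n
      rw [abs_of_pos (hσ0.trans_le hle), abs_of_pos hβ0] at h1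
      exact absurd (hn.trans (nsmul_le_nsmul_right hle n)) (not_le.2 h1)
  have hδ : ∀ β : valGroup v, 0 < β →
      ((∃ δ : valGroup (restrictVal K v), (δ : Γ) = q • (β : Γ) ∧
          ¬ IsDiscretelyOrdered (ArchComponent δ)) ↔
        ∀ N : ℕ, ∃ h ∈ baseGroup K v, 0 < h ∧ N • h ≤ q • β ∧ ∃ m : ℕ, q • β ≤ m • h) := by
    intro β hβ0
    have hqβ : 0 < q • β := nsmul_pos hβ0 hq.ne_zero
    constructor
    · rintro ⟨δ, h1, h2⟩
      exact (not_isDiscretelyOrdered_archComponent_restrict_iff hqβ h1).1 h2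
    · intro h2
      exact ⟨⟨(q • β : valGroup v), nsmul_mem_of_index_eq he β⟩, rfl,
        (not_isDiscretelyOrdered_archComponent_restrict_iff (K := K) hqβ rfl).2 h2⟩
  rw [hC]
  constructor
  · intro hA
    refine ⟨fun β hβ0 hβ n => nsmul_lt_of_forall_exists_coset hq.one_le hA n hβ0 hβ, ?_⟩
    intro c hc hpos hemp
    have hc0 : algebraMap K L c ≠ 0 := (_root_.map_ne_zero _).2 hc
    have hβ0 := (val_pos_iff v (mul_ne_zero hc0 hη0)).2 hpos
    refine (hδ _ hβ0).2 (exists_small_of_forall_exists_coset hq.two_le ht hA hβ0 ?_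
      ((hCP _ hβ0).1 hemp))
    rw [val_mul v hc0 hη0, add_sub_cancel_right]
    exact val_algebraMap_mem v hc
  · rintro ⟨h1, h2⟩ β hβ0 hβ
    refine forall_exists_coset_of_small hq.one_le h1 (fun β hβ0 hβ harch => ?_) hβ0 hβ
    obtain ⟨c, hc, rfl⟩ := exists_mul_val_eq hη0 hβ
    have hcη : algebraMap K L c * η ≠ 0 := mul_ne_zero ((_root_.map_ne_zero _).2 hc) hη0
    exact (hδ _ hβ0).1 (h2 c hc ((val_pos_iff v hcη).1 hβ0) ((hCP _ hβ0).2 harch))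

theorem KummerCaseI.disjoint_of_addVal_eq_zero (hq : q.Prime) (he : (baseGroup K v).index = q)
    (hK : IsKummerExtension K L q) {η : L} (h : KummerCaseI K v q η) (hv : v (q : L) = 0) :
    valSet v (kummerIdealI K v η) ∩ convexC (val v (q : L)) = ∅ := by
  rw [Set.eq_empty_iff_forall_notMem]
  rintro γ ⟨hγ, hγC⟩
  obtain ⟨β, hβ0, -, hle⟩ := (mem_valSet_kummerIdealI_iff hq he hK h).1 hγ
  have hval : val v (q : L) = 0 := by
    ext
    simp [val, hv]
  obtain ⟨n, hn⟩ := mem_convexC_iff.1 hγC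
  rw [hval, abs_zero, nsmul_zero, abs_of_pos (hβ0.trans_le hle)] at hn
  exact absurd (hβ0.trans_le hle) (not_lt.2 hn)

end

/-! ### Case (ii): the module of differentials and its nonvanishing. -/

section

open Polynomial

variable {K L Γ : Type*} [Field K] [Field L] [Algebra K L]
  [AddCommGroup Γ] [LinearOrder Γ] [IsOrderedAddMonoid Γ]
  {v : AddValuation L (WithTop Γ)} {q : ℕ} {ζ : K} {η : L} {j : ℕ}

/-- This is `v (c ξ ^ j) > 0` with one factor `ξ` split off. It keeps the weights in `O_L` and later
bounds the values of `I ^ q`. -/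
theorem KummerCaseII.neg_val_lt (h : KummerCaseII v q ζ η j)
    (c : Multiplier K v (kummerXi ζ η ^ j)) :
    -val v (kummerXi ζ η) < val v (algebraMap K L c.1 * kummerXi ζ η ^ (j - 1)) := by
  have hξ0 := ne_zero_of_addVal_neg h.neg
  have hc0 : algebraMap K L c.1 ≠ 0 := (_root_.map_ne_zero _).2 c.2.1
  have h1 := (val_pos_iff v (mul_ne_zero hc0 (pow_ne_zero j hξ0))).2 c.2.2
  have h2 : algebraMap K L c.1 * kummerXi ζ η ^ j =
      algebraMap K L c.1 * kummerXi ζ η ^ (j - 1) * kummerXi ζ η := by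
    rw [mul_assoc, ← pow_succ, Nat.sub_add_cancel h.one_le]
  rw [h2, val_mul v (mul_ne_zero hc0 (pow_ne_zero _ hξ0)) hξ0] at h1
  exact neg_lt_iff_pos_add.2 h1

theorem KummerCaseII.weight_ne_zero (h : KummerCaseII v q ζ η j)
    (c : Multiplier K v (kummerXi ζ η ^ j)) :
    algebraMap K L c.1 * kummerXi ζ η ^ (j - 1) ≠ 0 :=
  mul_ne_zero ((_root_.map_ne_zero _).2 c.2.1) (pow_ne_zero _ (ne_zero_of_addVal_neg h.neg))

theorem KummerCaseII.weight_nonneg (h : KummerCaseII v q ζ η j)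
    (c : Multiplier K v (kummerXi ζ η ^ j)) :
    0 ≤ v (algebraMap K L c.1 * kummerXi ζ η ^ (j - 1)) := by
  rw [← val_nonneg_iff v (h.weight_ne_zero c)]
  have h1 := (val_neg_iff v (ne_zero_of_addVal_neg h.neg)).2 h.neg
  exact ((neg_pos.2 h1).trans (h.neg_val_lt c)).le

theorem KummerCaseII.kummerIdealII_eq_span_range (h : KummerCaseII v q ζ η j) :
    kummerIdealII v ζ η j = Ideal.span (Set.range (Multiplier.weight h.weight_nonneg)) := by
  refine le_antisymm (Ideal.span_mono ?_) (Ideal.span_mono ?_)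
  · rintro x ⟨c, hc0, hc, hx⟩
    exact ⟨⟨c, hc0, hc⟩, Subtype.ext hx.symm⟩
  · rintro _ ⟨c, rfl⟩
    exact ⟨c.1, c.2.1, c.2.2, rfl⟩

theorem KummerCaseII.isGeneratingChain (hq : q.Prime) (he : (baseGroup K v).index = q)
    (hK : IsKummerExtension K L q) (h : KummerCaseII v q ζ η j) :
    IsGeneratingChain (valRing (restrictVal K v))
      (Multiplier.gen (K := K) (v := v) (θ := kummerXi ζ η ^ j))
      (Multiplier.weight h.weight_nonneg) :=
  have := hK.isGalois
  isGeneratingChain_multiplier hq he hK.finrank_eq h.generates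
    (pow_ne_zero _ (ne_zero_of_addVal_neg h.neg)) _

theorem KummerCaseII.addVal_natCast_eq_zero (hq : q.Prime) (h : KummerCaseII v q ζ η j) :
    v (j : L) = 0 := by
  refine _root_.addVal_natCast_eq_zero ((charP_residueField_iff hq).1 h.residueChar) ?_
  refine Nat.Coprime.symm ((Nat.Prime.coprime_iff_not_dvd hq).2 ?_)
  have h1 := h.one_le
  have h2 := h.le_pred
  exact Nat.not_dvd_of_pos_of_lt h1 (by omega)

/-- Each of the `q - 1` differences of `c ξ ^ j` and its other conjugates has the value of the
weight `c ξ ^ (j - 1)`; the weight itself is the `q`-th factor. -/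
theorem KummerCaseII.addVal_weight_mul_derivative (hq : q.Prime)
    (he : (baseGroup K v).index = q) (hK : IsKummerExtension K L q) (hζ : IsPrimitiveRoot ζ q)
    (h : KummerCaseII v q ζ η j) (c : Multiplier K v (kummerXi ζ η ^ j)) :
    v ((c.weight h.weight_nonneg *
      aeval c.gen (derivative (minpoly (valRing (restrictVal K v)) c.gen)) : valRing v) : L) =
      v ((c.weight h.weight_nonneg ^ q : valRing v) : L) := by
  have := hK.finiteDimensional hq
  have := hK.isGalois
  have hconj : ∀ σ : L ≃ₐ[K] L,
      σ (algebraMap K L c.1 * kummerXi ζ η ^ j) ≠ algebraMap K L c.1 * kummerXi ζ η ^ j →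
      v (algebraMap K L c.1 * kummerXi ζ η ^ j - σ (algebraMap K L c.1 * kummerXi ζ η ^ j)) =
        v (algebraMap K L c.1 * kummerXi ζ η ^ (j - 1)) := by
    intro σ hσ
    rw [map_mul, σ.commutes, map_pow] at hσ ⊢
    have hση : σ η ≠ η := by
      intro h1
      refine hσ ?_
      have : σ (kummerXi ζ η) = kummerXi ζ η := by
        unfold kummerXi
        rw [map_div₀, map_sub, map_sub, map_one, σ.commutes, h1]
      rw [this]
    rw [← mul_sub, v.map_mul, v.map_mul, addVal_pow_sub_pow h.neg
      (addVal_algEquiv_kummerXi_sub hq hζ h.generator h.oneUnit hση) h.one_le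
      (h.addVal_natCast_eq_zero hq)]
  have h1 := addVal_aeval_derivative_minpoly hconj
  rw [natDegree_minpoly_of_adjoin_eq_top
    (adjoin_algebraMap_mul_eq_top h.generates.adjoin_eq_top c.2.1), hK.finrank_eq] at h1
  have h2 := coe_aeval_derivative_minpoly ((h.isGeneratingChain hq he hK).integral c)
  change v (algebraMap K L c.1 * kummerXi ζ η ^ (j - 1) * ((aeval c.gen (derivative
    (minpoly (valRing (restrictVal K v)) c.gen)) : valRing v) : L)) =
      v ((algebraMap K L c.1 * kummerXi ζ η ^ (j - 1)) ^ q)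
  rw [h2]
  change v (algebraMap K L c.1 * kummerXi ζ η ^ (j - 1) *
    aeval (algebraMap K L c.1 * kummerXi ζ η ^ j)
      (derivative (minpoly K (algebraMap K L c.1 * kummerXi ζ η ^ j)))) = _
  rw [v.map_mul, h1, v.map_pow, ← succ_nsmul', Nat.sub_add_cancel hq.one_le]

theorem KummerCaseII.kaehlerDifferential_equiv (hq : q.Prime) (he : (baseGroup K v).index = q)
    (hK : IsKummerExtension K L q) (hζ : IsPrimitiveRoot ζ q) (h : KummerCaseII v q ζ η j) :
    Nonempty (Ω[valRing v⁄valRing (restrictVal K v)] ≃ₗ[valRing v]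
      (kummerIdealII v ζ η j ⧸
        (kummerIdealII v ζ η j ^ q).submoduleOf (kummerIdealII v ζ η j))) := by
  have hchain := h.isGeneratingChain hq he hK
  have hval := h.addVal_weight_mul_derivative hq he hK hζ
  have hpow : ∀ c : Multiplier K v (kummerXi ζ η ^ j),
      ((c.weight h.weight_nonneg ^ q : valRing v) : L) ≠ 0 := fun c =>
    pow_ne_zero q (h.weight_ne_zero c)
  have hequiv := hchain.nonempty_kaehlerDifferential_equiv (N := kummerIdealII v ζ η j ^ q)
    (fun c => by
      obtain ⟨a, ha⟩ := exists_eq_mul_of_addVal_le (hpow c) (hval c).ge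
      rw [ha, h.kummerIdealII_eq_span_range]
      exact Ideal.mul_mem_left _ _ (Ideal.pow_mem_pow (Ideal.subset_span (Set.mem_range_self c)) q))
    (fun x hx => by
      rw [h.kummerIdealII_eq_span_range] at hx
      obtain ⟨c, a, rfl⟩ := hchain.exists_mul_pow_eq_of_mem_span_pow q hx
      have hne : ((c.weight h.weight_nonneg *
          aeval c.gen (derivative (minpoly (valRing (restrictVal K v)) c.gen)) : valRing v) : L)
          ≠ 0 := by
        intro h0
        have h1 := hval c
        rw [h0, v.map_zero] at h1
        exact hpow c (v.top_iff.1 h1.symm)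
      obtain ⟨b, hb⟩ := exists_eq_mul_of_addVal_le hne (hval c).le
      exact ⟨c, a * b, by rw [hb, mul_assoc]⟩)
  rwa [← h.kummerIdealII_eq_span_range] at hequiv

/-- Weights have value above `-v ξ`, so elements of `I ^ q` have value above `-q v ξ`. The
multiplier with `v c = -q v ξ` is admissible as `j < q`, and its weight has value at most `-q v ξ`.
-/
theorem KummerCaseII.nontrivial_kaehlerDifferential (hq : q.Prime)
    (he : (baseGroup K v).index = q) (hK : IsKummerExtension K L q) (hζ : IsPrimitiveRoot ζ q)
    (h : KummerCaseII v q ζ η j) :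
    Nontrivial (Ω[valRing v⁄valRing (restrictVal K v)]) := by
  obtain ⟨e⟩ := h.kaehlerDifferential_equiv hq he hK hζ
  rw [← not_subsingleton_iff_nontrivial, e.toEquiv.subsingleton_congr,
    subsingleton_quotient_submoduleOf_iff]
  intro hle
  set ξ := kummerXi ζ η with hξ
  have hξ0 : ξ ≠ 0 := ne_zero_of_addVal_neg h.neg
  have hneg : val v ξ < 0 := (val_neg_iff v hξ0).2 h.neg
  have hjq : j < q := by
    have h1 := h.le_pred
    have h2 := hq.pos
    omega
  -- an element `c ξ ^ (j - 1)` of `I` of value `(q - j + 1) (-v ξ)`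
  obtain ⟨c, hc, hcval⟩ := (mem_baseGroup_iff v).1
    (neg_mem (nsmul_mem_of_index_eq he (val v ξ)))
  have hc0 : algebraMap K L c ≠ 0 := (_root_.map_ne_zero _).2 hc
  have hlt : q • val v ξ < j • val v ξ := by
    have h1 := nsmul_lt_nsmul_left (neg_pos.2 hneg) hjq
    rw [smul_neg, smul_neg] at h1
    exact neg_lt_neg_iff.1 h1
  have hpos : 0 < v (algebraMap K L c * ξ ^ j) := by
    rw [← val_pos_iff v (mul_ne_zero hc0 (pow_ne_zero j hξ0)), val_mul_pow hc hξ0, hcval]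
    exact neg_add_eq_sub (q • val v ξ) (j • val v ξ) ▸ sub_pos.2 hlt
  let c' : Multiplier K v (ξ ^ j) := ⟨c, hc, hpos⟩
  have hmem : c'.weight h.weight_nonneg ∈ kummerIdealII v ζ η j ^ q := by
    refine hle ?_
    rw [h.kummerIdealII_eq_span_range]
    exact Ideal.subset_span ⟨c', rfl⟩
  rw [h.kummerIdealII_eq_span_range] at hmem
  obtain ⟨d, a, hda⟩ := (h.isGeneratingChain hq he hK).exists_mul_pow_eq_of_mem_span_pow q hmem
  have heq : algebraMap K L c * ξ ^ (j - 1) =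
      (a : L) * (algebraMap K L d.1 * ξ ^ (j - 1)) ^ q := congrArg Subtype.val hda
  have hd0 := h.weight_ne_zero d
  have ha0 : (a : L) ≠ 0 := by
    intro h0
    rw [h0, zero_mul] at heq
    exact h.weight_ne_zero c' heq
  have hval := congrArg (val v) heq
  rw [val_mul_pow hc hξ0, hcval, val_mul v ha0 (pow_ne_zero q hd0), val_pow v hd0] at hval
  have h1 := (val_nonneg_iff v ha0).2 a.2
  have h2 := nsmul_lt_nsmul_right hq.ne_zero (h.neg_val_lt d)
  have h3 : (j - 1) • val v ξ ≤ 0 := nsmul_nonpos hneg.le _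
  rw [smul_neg] at h2
  have h4 : -(q • val v ξ) + (j - 1) • val v ξ ≤ -(q • val v ξ) := add_le_of_nonpos_right h3
  rw [hval] at h4
  exact absurd (h4.trans_lt h2) (not_lt.2 (le_add_of_nonneg_left h1))

end

theorem mainTheorem6 {K L Γ : Type*} [Field K] [Field L] [Algebra K L]
    [AddCommGroup Γ] [LinearOrder Γ] [IsOrderedAddMonoid Γ]
    (v : AddValuation L (WithTop Γ)) (q : ℕ) (hq : q.Prime)
    (hKummer : IsKummerExtension K L q)
    (he : (valGroup (restrictVal K v)).relIndex (valGroup v) = q) :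
    -- at least one of the two cases occurs, and case (i) always occurs if `q ≠ char Kv`
    (∀ ζ : K, IsPrimitiveRoot ζ q →
      (∃ η : L, KummerCaseI K v q η) ∨ (∃ (η : L) (j : ℕ), KummerCaseII v q ζ η j)) ∧
    (¬ CharP (IsLocalRing.ResidueField (valRing (restrictVal K v))) q →
      ∃ η : L, KummerCaseI K v q η) ∧
    -- case (i)
    (∀ η : L, KummerCaseI K v q η →
      Nonempty (Ω[valRing v⁄valRing (restrictVal K v)] ≃ₗ[valRing v]
        (kummerIdealI K v η ⧸
          (Ideal.span {(q : valRing v)} * kummerIdealI K v η ^ q).submoduleOf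
            (kummerIdealI K v η))) ∧
      (Subsingleton (Ω[valRing v⁄valRing (restrictVal K v)]) ↔
        valSet v (kummerIdealI K v η) ∩ convexC (val v (q : L)) = ∅ ∧
        ∀ c : K, c ≠ 0 → 0 < v (algebraMap K L c * η) →
          valSet v (kummerIdealI K v η) ∩ convexCPlus (val v (algebraMap K L c * η)) = ∅ →
          ∃ δ : valGroup (restrictVal K v),
            (δ : Γ) = q • (val v (algebraMap K L c * η) : Γ) ∧
            ¬ IsDiscretelyOrdered (ArchComponent δ)) ∧
      (¬ CharP (IsLocalRing.ResidueField (valRing (restrictVal K v))) q →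
        v (q : L) = 0 ∧
        valSet v (kummerIdealI K v η) ∩ convexC (val v (q : L)) = ∅)) ∧
    -- case (ii)
    (∀ (ζ : K) (η : L) (j : ℕ), IsPrimitiveRoot ζ q → KummerCaseII v q ζ η j →
      Nonempty (Ω[valRing v⁄valRing (restrictVal K v)] ≃ₗ[valRing v]
        (kummerIdealII v ζ η j ⧸
          (kummerIdealII v ζ η j ^ q).submoduleOf (kummerIdealII v ζ η j))) ∧
      Nontrivial (Ω[valRing v⁄valRing (restrictVal K v)])) := by
  have he' : (baseGroup K v).index = q := he
  have hI : v (q : L) = 0 → ∃ η : L, KummerCaseI K v q η :=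
    exists_kummerCaseI_of_addVal_eq_zero hq he' hKummer
  have hv : ¬ CharP (IsLocalRing.ResidueField (valRing (restrictVal K v))) q → v (q : L) = 0 := by
    rw [charP_residueField_iff hq, not_lt]
    exact fun h => le_antisymm h (addVal_natCast_nonneg v q)
  refine ⟨fun ζ hζ => ?_, fun h => hI (hv h), fun η h => ?_, fun ζ η j hζ h => ?_⟩
  · rcases (addVal_natCast_nonneg v q).eq_or_lt with h0 | hpos
    · exact Or.inl (hI h0.symm)
    · obtain ⟨η, hη⟩ := exists_isKummerGenerator hq hKummer
      -- Once `v q > 0`, the value of an arbitrary Kummer generator decides which case is produced.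
      by_cases hηv : val v η ∈ baseGroup K v
      · exact Or.inr (exists_kummerCaseII hq he' hKummer hpos hη hηv hζ)
      · obtain ⟨a, ha⟩ := hη.2
        exact Or.inl (exists_kummerCaseI_of_val_notMem hq he' hKummer.finrank_eq hηv ha)
  · exact ⟨h.kaehlerDifferential_equiv hq he' hKummer, h.subsingleton_iff hq he' hKummer,
      fun hchar => ⟨hv hchar, h.disjoint_of_addVal_eq_zero hq he' hKummer (hv hchar)⟩⟩
  · exact ⟨h.kaehlerDifferential_equiv hq he' hKummer hζ,
      h.nontrivial_kaehlerDifferential hq he' hKummer hζ⟩
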